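/- Let $\Gamma$ be a countable discrete group and $\Lambda\le\Gamma$ a subgroup. A tracial state on a unital $*$-algebra is a positive linear functional $\tau$ with $\tau(1)=1$ and $\tau(ab)=\tau(ba)$ for all $a,b$. Write $\tau_0^\Gamma$ for the canonical trace on the full group $C^*$-algebra $C^*(\Gamma)$, i.e. the continuous extension of $\sum_g c_g g\mapsto c_e$, and likewise $\tau_0^\Lambda$ on $C^*(\Lambda)\subseteq C^*(\Gamma)$. Suppose that the pair $(\Gamma,\Lambda)$ is tracial rigid, that is, $\tau_0^\Gamma$ is the unique tracial state on $C^*(\Gamma)$ whose restriction to $C^*(\Lambda)$ is $\tau_0^\Lambda$. Suppose also that $\Lambda$ is icc, that is, the conjugacy class in $\Lambda$ of every $h\in\Lambda\setminus\{e\}$ is infinite. Let $\pi:\Gamma\to\mathcal U(\mathcal H)$ be a unitary representation on a complex Hilbert space such that the von Neumann algebra $M=\pi(\Gamma)''$ is finite, that is, $M$ has a faithful normal tracial state. For a group $G$ let $\mathcal L(G)=\lambda(G)''\subseteq\mathcal B(\ell^2(G))$ be the group von Neumann algebra, where $\lambda$ is the left regular representation. If $\pi|_\Lambda$ extends to an isomorphism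 $\mathcal L(\Lambda)\cong\pi(\Lambda)''$, i.e. there is a $*$-isomorphism $\mathcal L(\Lambda)\to\pi(\Lambda)''$ with $\lambda_h\mapsto\pi(h)$ for all $h\in\Lambda$, then $\pi$ extends to an isomorphism $\mathcal L(\Gamma)\cong M$, i.e. there is a $*$-isomorphism $\mathcal L(\Gamma)\to M$ with $\lambda_g\mapsto\pi(g)$ for all $g\in\Gamma$. -/

import Mathlib

open scoped InnerProductSpace

noncomputable section

/-! ### The complex group algebra as a star algebra -/

/-- The complex group algebra of `Γ`: finite formal sums `∑ c_g g` with convolution. -/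
def GroupAlg (Γ : Type*) [Group Γ] : Type _ := MonoidAlgebra ℂ Γ

namespace GroupAlg

variable {Γ : Type*} [Group Γ]

instance instRing : Ring (GroupAlg Γ) := inferInstanceAs (Ring (MonoidAlgebra ℂ Γ))

instance instAlgebra : Algebra ℂ (GroupAlg Γ) := inferInstanceAs (Algebra ℂ (MonoidAlgebra ℂ Γ))

/-- The element `c • g` of the group algebra. -/
def single (g : Γ) (c : ℂ) : GroupAlg Γ := MonoidAlgebra.single g c

theorem single_mul_single (g h : Γ) (c d : ℂ) :
    single g c * single h d = single (g * h) (c * d) :=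
  MonoidAlgebra.single_mul_single g h c d

theorem one_eq_single : (1 : GroupAlg Γ) = single 1 1 := rfl

theorem smul_single (z : ℂ) (g : Γ) (c : ℂ) : z • single g c = single g (z * c) :=
  MonoidAlgebra.smul_single z g c

theorem induction_linear {P : GroupAlg Γ → Prop} (a : GroupAlg Γ) (zero : P 0)
    (add : ∀ x y, P x → P y → P (x + y)) (single : ∀ g c, P (single g c)) : P a :=
  MonoidAlgebra.induction_linear (motive := P) a zero add single

/-- The map `g ↦ g⁻¹` into the opposite of the group algebra. -/
def invHom : Γ →* (MonoidAlgebra ℂ Γ)ᵐᵒᵖ where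
  toFun g := MulOpposite.op (MonoidAlgebra.single g⁻¹ 1)
  map_one' := by rw [inv_one]; rfl
  map_mul' g h := by
    rw [← MulOpposite.op_mul, MonoidAlgebra.single_mul_single, mul_inv_rev, mul_one]

/-- The involution of the group algebra as a ring homomorphism into the opposite ring. -/
def starHom : MonoidAlgebra ℂ Γ →+* (MonoidAlgebra ℂ Γ)ᵐᵒᵖ :=
  MonoidAlgebra.liftNCRingHom
    ((algebraMap ℂ (MonoidAlgebra ℂ Γ)ᵐᵒᵖ).comp (starRingEnd ℂ)) invHom
    (fun x g => Algebra.commutes (starRingEnd ℂ x) (invHom g))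

theorem starHom_single (g : Γ) (c : ℂ) :
    starHom (MonoidAlgebra.single g c) =
      MulOpposite.op (MonoidAlgebra.single g⁻¹ (star c)) := by
  have h : starHom (MonoidAlgebra.single g c) =
      algebraMap ℂ (MonoidAlgebra ℂ Γ)ᵐᵒᵖ (star c) * invHom g :=
    MonoidAlgebra.liftNCRingHom_single _ _ _ g c
  have h2 : invHom g = MulOpposite.op (MonoidAlgebra.single g⁻¹ (1 : ℂ)) := rfl
  rw [h, h2, ← Algebra.smul_def, ← MulOpposite.op_smul, MonoidAlgebra.smul_single,
    smul_eq_mul, mul_one]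

/-- The involution `(∑ c_g g)^* = ∑ conj (c_g) g⁻¹`. -/
instance instStarRing : StarRing (GroupAlg Γ) where
  star a := (starHom a).unop
  star_involutive a := by
    change (starHom (starHom a).unop).unop = a
    induction a using MonoidAlgebra.induction_linear with
    | zero => simp
    | add x y hx hy => simp only [map_add, MulOpposite.unop_add, hx, hy]
    | single g c => simp [starHom_single]
  star_mul a b := congrArg MulOpposite.unop (map_mul starHom a b)
  star_add a b := congrArg MulOpposite.unop (map_add starHom a b)

theorem star_single (g : Γ) (c : ℂ) : star (single g c) = single g⁻¹ (star c) :=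
  congrArg MulOpposite.unop (starHom_single g c)

instance instStarModule : StarModule ℂ (GroupAlg Γ) where
  star_smul z a := by
    induction a using induction_linear with
    | zero => simp
    | add x y hx hy => simp only [smul_add, star_add, hx, hy]
    | single g c => simp only [smul_single, star_single, star_mul']

/-! ### The largest C⋆-seminorm on the group algebra -/

/-- A C⋆-seminorm on the group algebra: a submultiplicative seminorm with the C⋆-identity.
These are exactly the seminorms `a ↦ ‖φ a‖` for `φ` a star homomorphism into a C⋆-algebra. -/
structure IsCStarSeminorm (p : Seminorm ℂ (GroupAlg Γ)) : Prop where
  mul_le : ∀ a b, p (a * b) ≤ p a * p b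
  star_mul_self : ∀ a, p (star a * a) = p a ^ 2

theorem IsCStarSeminorm.single_le {p : Seminorm ℂ (GroupAlg Γ)} (hp : IsCStarSeminorm p)
    (g : Γ) (c : ℂ) : p (single g c) ≤ ‖c‖ := by
  have h1 : p 1 ≤ 1 := by
    have h := hp.star_mul_self 1
    rw [star_one, one_mul] at h
    nlinarith [apply_nonneg p (1 : GroupAlg Γ)]
  have hg : p (single g 1) ≤ 1 := by
    have h := hp.star_mul_self (single g 1)
    rw [star_single, single_mul_single, inv_mul_cancel, star_one, one_mul,
      ← one_eq_single] at h
    nlinarith [apply_nonneg p (single g (1 : ℂ))]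
  have h2 : single g c = c • single g 1 := by rw [smul_single, mul_one]
  rw [h2, map_smul_eq_mul]
  exact mul_le_of_le_one_right (norm_nonneg c) hg

theorem bddAbove_seminorms (a : GroupAlg Γ) : BddAbove (Set.range
    fun p : {p : Seminorm ℂ (GroupAlg Γ) // IsCStarSeminorm p} => p.1 a) := by
  suffices h : ∃ C, ∀ p : Seminorm ℂ (GroupAlg Γ), IsCStarSeminorm p → p a ≤ C by
    obtain ⟨C, hC⟩ := h
    exact ⟨C, by rintro _ ⟨p, rfl⟩; exact hC p.1 p.2⟩
  induction a using induction_linear with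
  | zero => exact ⟨0, fun p _ => (map_zero p).le⟩
  | add x y hx hy =>
    obtain ⟨C, hC⟩ := hx
    obtain ⟨D, hD⟩ := hy
    exact ⟨C + D, fun p hp => (map_add_le_add p x y).trans (add_le_add (hC p hp) (hD p hp))⟩
  | single g c => exact ⟨‖c‖, fun p hp => hp.single_le g c⟩

instance instNonemptySeminorms :
    Nonempty {p : Seminorm ℂ (GroupAlg Γ) // IsCStarSeminorm p} :=
  ⟨⟨0, ⟨fun a b => by simp, fun a => by simp⟩⟩⟩

/-- The universal norm: the supremum of all C⋆-seminorms. -/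
def univNorm (a : GroupAlg Γ) : ℝ :=
  ⨆ p : {p : Seminorm ℂ (GroupAlg Γ) // IsCStarSeminorm p}, p.1 a

theorem IsCStarSeminorm.le_univNorm {p : Seminorm ℂ (GroupAlg Γ)} (hp : IsCStarSeminorm p)
    (a : GroupAlg Γ) : p a ≤ univNorm a :=
  le_ciSup (bddAbove_seminorms a) ⟨p, hp⟩

theorem univNorm_le {a : GroupAlg Γ} {C : ℝ}
    (h : ∀ p : Seminorm ℂ (GroupAlg Γ), IsCStarSeminorm p → p a ≤ C) : univNorm a ≤ C :=
  ciSup_le fun p => h p.1 p.2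

theorem univNorm_nonneg (a : GroupAlg Γ) : 0 ≤ univNorm a :=
  Real.iSup_nonneg fun p => apply_nonneg p.1 a

/-- The universal norm as a ring seminorm. -/
def univRingSeminorm : RingSeminorm (GroupAlg Γ) where
  toFun := univNorm
  map_zero' := le_antisymm (univNorm_le fun p _ => (map_zero p).le) (univNorm_nonneg 0)
  add_le' a b := univNorm_le fun p hp =>
    (map_add_le_add p a b).trans (add_le_add (hp.le_univNorm a) (hp.le_univNorm b))
  neg' a := by
    unfold univNorm
    congr 1
    funext p
    exact map_neg_eq_map p.1 a
  mul_le' a b := univNorm_le fun p hp => (hp.mul_le a b).trans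
    (mul_le_mul (hp.le_univNorm a) (hp.le_univNorm b) (apply_nonneg p b) (univNorm_nonneg a))

instance instSeminormedRing : SeminormedRing (GroupAlg Γ) where
  __ := instRing
  __ := (univRingSeminorm (Γ := Γ)).toAddGroupSeminorm.toSeminormedAddCommGroup
  norm_mul_le := (univRingSeminorm (Γ := Γ)).mul_le'

theorem norm_def (a : GroupAlg Γ) : ‖a‖ = univNorm a := rfl

instance instNormedAlgebra : NormedAlgebra ℂ (GroupAlg Γ) where
  norm_smul_le z a := univNorm_le fun p hp => by
    rw [map_smul_eq_mul]
    exact mul_le_mul_of_nonneg_left (hp.le_univNorm a) (norm_nonneg z)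

theorem norm_single_le (g : Γ) (c : ℂ) : ‖single g c‖ ≤ ‖c‖ :=
  univNorm_le fun _ hp => hp.single_le g c

theorem norm_sq_le (a : GroupAlg Γ) : ‖a‖ ^ 2 ≤ ‖star a * a‖ := by
  have h : ‖a‖ ≤ √‖star a * a‖ := univNorm_le fun p hp => by
    apply Real.le_sqrt_of_sq_le
    rw [← hp.star_mul_self a]
    exact hp.le_univNorm _
  calc ‖a‖ ^ 2 ≤ √‖star a * a‖ ^ 2 := by gcongr
    _ = ‖star a * a‖ := Real.sq_sqrt (norm_nonneg _)

theorem norm_le_norm_star (a : GroupAlg Γ) : ‖a‖ ≤ ‖star a‖ := by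
  have h := (norm_sq_le a).trans (norm_mul_le _ _)
  rcases (norm_nonneg a).eq_or_lt with h0 | h0
  · rw [← h0]; exact norm_nonneg _
  · nlinarith

instance instNormedStarGroup : NormedStarGroup (GroupAlg Γ) where
  norm_star_le a := by simpa using norm_le_norm_star (star a)

end GroupAlg

/-! ### The full group C⋆-algebra -/

/-- The full group C⋆-algebra `C⋆(Γ)`: the completion of the complex group algebra in its largest
C⋆-seminorm. -/
def FullGroupCStar (Γ : Type*) [Group Γ] : Type _ := UniformSpace.Completion (GroupAlg Γ)

namespace FullGroupCStar

open UniformSpace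

variable {Γ : Type*} [Group Γ]

instance instNormedRing : NormedRing (FullGroupCStar Γ) :=
  inferInstanceAs (NormedRing (Completion (GroupAlg Γ)))

instance instCompleteSpace : CompleteSpace (FullGroupCStar Γ) :=
  inferInstanceAs (CompleteSpace (Completion (GroupAlg Γ)))

instance instNormedAlgebra : NormedAlgebra ℂ (FullGroupCStar Γ) where
  __ := (inferInstanceAs (Algebra ℂ (Completion (GroupAlg Γ))) : Algebra ℂ (FullGroupCStar Γ))
  norm_smul_le z a := norm_smul_le z (show Completion (GroupAlg Γ) from a)

/-- The canonical map from the group algebra to the full group C⋆-algebra. -/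
def coeHom : GroupAlg Γ →ₐ[ℂ] FullGroupCStar Γ where
  __ := (Completion.coeRingHom : GroupAlg Γ →+* Completion (GroupAlg Γ))
  commutes' _ := rfl

theorem norm_coeHom (a : GroupAlg Γ) : ‖coeHom a‖ = ‖a‖ := Completion.norm_coe a

theorem isometry_coeHom : Isometry (coeHom : GroupAlg Γ → FullGroupCStar Γ) :=
  AddMonoidHomClass.isometry_of_norm coeHom norm_coeHom

theorem denseRange_coeHom : DenseRange (coeHom : GroupAlg Γ → FullGroupCStar Γ) :=
  Completion.denseRange_coe

theorem induction_on {P : FullGroupCStar Γ → Prop} (a : FullGroupCStar Γ)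
    (hc : IsClosed {a | P a}) (h : ∀ a : GroupAlg Γ, P (coeHom a)) : P a :=
  Completion.induction_on a hc h

instance instStar : Star (FullGroupCStar Γ) where
  star := Completion.map (star : GroupAlg Γ → GroupAlg Γ)

theorem uniformContinuous_star_groupAlg :
    UniformContinuous (star : GroupAlg Γ → GroupAlg Γ) :=
  (AddMonoidHomClass.isometry_of_norm (starAddEquiv (R := GroupAlg Γ)) norm_star).uniformContinuous

theorem star_coeHom (a : GroupAlg Γ) : star (coeHom a) = coeHom (star a) :=
  Completion.map_coe uniformContinuous_star_groupAlg a

theorem continuous_star' : Continuous (star : FullGroupCStar Γ → FullGroupCStar Γ) :=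
  Completion.continuous_map

instance instStarRing : StarRing (FullGroupCStar Γ) where
  star_involutive a := by
    induction a using induction_on with
    | hc => exact isClosed_eq (continuous_star'.comp continuous_star') continuous_id
    | h a => rw [star_coeHom, star_coeHom, star_star]
  star_mul a b := by
    induction a using induction_on with
    | hc => exact isClosed_eq (continuous_star'.comp (continuous_mul_const b))
              ((continuous_const_mul _).comp continuous_star')
    | h a =>
      induction b using induction_on with
      | hc => exact isClosed_eq (continuous_star'.comp (continuous_const_mul _))
                ((continuous_mul_const _).comp continuous_star')
      | h b => rw [← map_mul, star_coeHom, star_mul, map_mul, star_coeHom, star_coeHom]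
  star_add a b := by
    induction a using induction_on with
    | hc => exact isClosed_eq (continuous_star'.comp (continuous_add_const b))
              ((continuous_add_const _).comp continuous_star')
    | h a =>
      induction b using induction_on with
      | hc => exact isClosed_eq (continuous_star'.comp (continuous_const_add _))
                ((continuous_const_add _).comp continuous_star')
      | h b => rw [← map_add, star_coeHom, star_add, map_add, star_coeHom, star_coeHom]

instance instCStarAlgebra : CStarAlgebra (FullGroupCStar Γ) where
  star_smul z a := by
    induction a using induction_on with
    | hc => exact isClosed_eq (continuous_star'.comp (continuous_const_smul z))
              ((continuous_const_smul _).comp continuous_star')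
    | h a => rw [← map_smul, star_coeHom, star_smul, map_smul, star_coeHom]
  norm_mul_self_le a := by
    induction a using induction_on with
    | hc => exact isClosed_le (continuous_norm.mul continuous_norm)
              (continuous_norm.comp (continuous_star'.mul continuous_id))
    | h a =>
      rw [star_coeHom, ← map_mul, norm_coeHom, norm_coeHom, ← sq]
      exact GroupAlg.norm_sq_le a

/-- The canonical homomorphism of `Γ` into the unitary group of `C⋆(Γ)`. -/
def of : Γ →* unitary (FullGroupCStar Γ) where
  toFun g := ⟨coeHom (GroupAlg.single g 1), by
    rw [Unitary.mem_iff, star_coeHom, GroupAlg.star_single, ← map_mul, ← map_mul,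
      GroupAlg.single_mul_single, GroupAlg.single_mul_single, inv_mul_cancel, mul_inv_cancel,
      star_one, one_mul, ← GroupAlg.one_eq_single, map_one]
    exact ⟨rfl, rfl⟩⟩
  map_one' := Subtype.ext (map_one coeHom)
  map_mul' g h := Subtype.ext <| by
    change coeHom (GroupAlg.single (g * h) 1) =
      coeHom (GroupAlg.single g 1) * coeHom (GroupAlg.single h 1)
    rw [← map_mul, GroupAlg.single_mul_single, one_mul]

section lift

variable {A : Type*} [CStarAlgebra A]

/-- The linear extension to the group algebra of a homomorphism of `Γ` into the unitary group
of a C⋆-algebra. -/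
def liftAlg (u : Γ →* unitary A) : GroupAlg Γ →⋆ₐ[ℂ] A where
  __ := (MonoidAlgebra.lift ℂ A Γ ((unitary A).subtype.comp u) : MonoidAlgebra ℂ Γ →ₐ[ℂ] A)
  map_star' a := by
    set F : GroupAlg Γ →ₐ[ℂ] A :=
      (MonoidAlgebra.lift ℂ A Γ ((unitary A).subtype.comp u) : MonoidAlgebra ℂ Γ →ₐ[ℂ] A) with hF
    have hs : ∀ g c, F (GroupAlg.single g c) = c • (u g : A) := fun g c =>
      MonoidAlgebra.lift_single _ _ _
    change F (star a) = star (F a)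
    induction a using GroupAlg.induction_linear with
    | zero => simp
    | add x y hx hy => rw [star_add, map_add, hx, hy, map_add, star_add]
    | single g c =>
      rw [GroupAlg.star_single, hs, hs, star_smul, map_inv, ← Unitary.star_eq_inv,
        Unitary.coe_star]

theorem liftAlg_single (u : Γ →* unitary A) (g : Γ) (c : ℂ) :
    liftAlg u (GroupAlg.single g c) = c • (u g : A) :=
  MonoidAlgebra.lift_single _ _ _

theorem norm_liftAlg_le (u : Γ →* unitary A) (a : GroupAlg Γ) : ‖liftAlg u a‖ ≤ ‖a‖ :=
  GroupAlg.IsCStarSeminorm.le_univNorm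
    (p := (normSeminorm ℂ A).comp (liftAlg u).toAlgHom.toLinearMap)
    { mul_le := fun a b => by
        change ‖liftAlg u (a * b)‖ ≤ ‖liftAlg u a‖ * ‖liftAlg u b‖
        rw [map_mul]; exact norm_mul_le _ _
      star_mul_self := fun a => by
        change ‖liftAlg u (star a * a)‖ = ‖liftAlg u a‖ ^ 2
        rw [map_mul, map_star, CStarRing.norm_star_mul_self, sq] } a

theorem uniformContinuous_liftAlg (u : Γ →* unitary A) : UniformContinuous (liftAlg u) :=
  (AddMonoidHomClass.lipschitz_of_bound (liftAlg u) 1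
    fun a => by rw [one_mul]; exact norm_liftAlg_le u a).uniformContinuous

/-- The universal property of `C⋆(Γ)`: every homomorphism `u` of `Γ` into the unitary group of a
C⋆-algebra extends to a star homomorphism of `C⋆(Γ)`. -/
def lift (u : Γ →* unitary A) : FullGroupCStar Γ →⋆ₐ[ℂ] A :=
  have hc : Continuous (Completion.extension (liftAlg u) : FullGroupCStar Γ → A) :=
    Completion.continuous_extension
  have he : ∀ a : GroupAlg Γ,
      (Completion.extension (liftAlg u) : FullGroupCStar Γ → A) (coeHom a) = liftAlg u a :=
    Completion.extension_coe (uniformContinuous_liftAlg u)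
  { toFun := (Completion.extension (liftAlg u) : FullGroupCStar Γ → A)
    map_one' := by rw [← map_one coeHom, he, map_one]
    map_zero' := by rw [← map_zero coeHom, he, map_zero]
    map_mul' := fun a b => by
      induction a using induction_on with
      | hc => exact isClosed_eq (hc.comp (continuous_mul_const b))
                ((continuous_mul_const _).comp hc)
      | h a =>
        induction b using induction_on with
        | hc => exact isClosed_eq (hc.comp (continuous_const_mul _))
                  ((continuous_const_mul _).comp hc)
        | h b => rw [← map_mul, he, he, he, map_mul]
    map_add' := fun a b => by
      induction a using induction_on with
      | hc => exact isClosed_eq (hc.comp (continuous_add_const b))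
                ((continuous_add_const _).comp hc)
      | h a =>
        induction b using induction_on with
        | hc => exact isClosed_eq (hc.comp (continuous_const_add _))
                  ((continuous_const_add _).comp hc)
        | h b => rw [← map_add, he, he, he, map_add]
    commutes' := fun z => by
      rw [← AlgHomClass.commutes coeHom z, he, AlgHomClass.commutes]
    map_star' := fun a => by
      induction a using induction_on with
      | hc => exact isClosed_eq (hc.comp continuous_star') (continuous_star.comp hc)
      | h a => rw [star_coeHom, he, he, map_star] }

theorem lift_coeHom (u : Γ →* unitary A) (a : GroupAlg Γ) :
    lift u (coeHom a) = liftAlg u a :=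
  Completion.extension_coe (uniformContinuous_liftAlg u) a

theorem lift_of (u : Γ →* unitary A) (g : Γ) : lift u (of g : FullGroupCStar Γ) = u g := by
  have h : ((of g : unitary (FullGroupCStar Γ)) : FullGroupCStar Γ) =
    coeHom (GroupAlg.single g 1) := rfl
  rw [h, lift_coeHom, liftAlg_single, one_smul]

end lift

/-- The canonical inclusion `C⋆(Λ) → C⋆(Γ)` for a subgroup `Λ` of `Γ`, sending `h` to `h`. -/
def incl (Λ : Subgroup Γ) : FullGroupCStar Λ →⋆ₐ[ℂ] FullGroupCStar Γ :=
  lift (of.comp Λ.subtype)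

end FullGroupCStar

/-! ### The left regular representation and the canonical trace -/

/-- The Hilbert space `ℓ²(Γ)`. -/
abbrev EllTwo (Γ : Type*) : Type _ := lp (fun _ : Γ => ℂ) 2

/-- Left translation by `g` on `ℓ²(Γ)`: `(λ_g ξ)(h) = ξ(g⁻¹ h)`. -/
def leftTranslate {Γ : Type*} [Group Γ] (g : Γ) (ξ : EllTwo Γ) : EllTwo Γ :=
  ⟨fun h => ξ (g⁻¹ * h), by
    have hξ := (memℓp_gen_iff (by norm_num)).mp (lp.memℓp ξ)
    exact (memℓp_gen_iff (by norm_num)).mpr ((Equiv.mulLeft g⁻¹).summable_iff.mpr hξ)⟩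

theorem leftTranslate_apply {Γ : Type*} [Group Γ] (g : Γ) (ξ : EllTwo Γ) (h : Γ) :
    leftTranslate g ξ h = ξ (g⁻¹ * h) := rfl

/-- Left translation as a unitary operator. -/
def leftTranslateEquiv {Γ : Type*} [Group Γ] (g : Γ) : EllTwo Γ ≃ₗᵢ[ℂ] EllTwo Γ where
  toFun := leftTranslate g
  invFun := leftTranslate g⁻¹
  left_inv ξ := lp.ext <| funext fun h => by simp [leftTranslate_apply]
  right_inv ξ := lp.ext <| funext fun h => by simp [leftTranslate_apply]
  map_add' ξ η := lp.ext <| funext fun h => by simp [leftTranslate_apply]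
  map_smul' c ξ := lp.ext <| funext fun h => by simp [leftTranslate_apply]
  norm_map' ξ := by
    change ‖leftTranslate g ξ‖ = ‖ξ‖
    rw [lp.norm_eq_tsum_rpow (by norm_num), lp.norm_eq_tsum_rpow (by norm_num)]
    congr 1
    exact (Equiv.mulLeft g⁻¹).tsum_eq (fun h => ‖ξ h‖ ^ (2 : ENNReal).toReal)

/-- The left regular representation of `Γ` on `ℓ²(Γ)`. -/
def leftRegular (Γ : Type*) [Group Γ] : Γ →* unitary (EllTwo Γ →L[ℂ] EllTwo Γ) where
  toFun g := Unitary.linearIsometryEquiv.symm (leftTranslateEquiv g)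
  map_one' := by
    refine Subtype.ext (ContinuousLinearMap.ext fun ξ => lp.ext (funext fun h => ?_))
    change leftTranslate 1 ξ h = ξ h
    simp [leftTranslate_apply]
  map_mul' g k := by
    refine Subtype.ext (ContinuousLinearMap.ext fun ξ => lp.ext (funext fun h => ?_))
    change leftTranslate (g * k) ξ h = leftTranslate g (leftTranslate k ξ) h
    simp [leftTranslate_apply, mul_assoc]

theorem leftRegular_apply {Γ : Type*} [Group Γ] (g : Γ) (ξ : EllTwo Γ) (h : Γ) :
    (leftRegular Γ g : EllTwo Γ →L[ℂ] EllTwo Γ) ξ h = ξ (g⁻¹ * h) := rfl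

/-- The basis vector `δ_e` of `ℓ²(Γ)`. -/
def deltaOne (Γ : Type*) [Group Γ] : EllTwo Γ :=
  haveI := Classical.decEq Γ
  lp.single 2 1 (1 : ℂ)

/-- The canonical trace `τ₀` on `C⋆(Γ)`: the vector functional of `δ_e` under the left regular
representation, that is, the continuous extension of `∑ c_g g ↦ c_e`. -/
def canonicalTrace (Γ : Type*) [Group Γ] : FullGroupCStar Γ →ₗ[ℂ] ℂ where
  toFun a := ⟪deltaOne Γ, FullGroupCStar.lift (leftRegular Γ) a (deltaOne Γ)⟫_ℂ
  map_add' a b := by rw [map_add, add_apply, inner_add_right]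
  map_smul' z a := by
    rw [map_smul, smul_apply, inner_smul_right, RingHom.id_apply, smul_eq_mul]

open scoped Classical in
theorem canonicalTrace_of {Γ : Type*} [Group Γ] (g : Γ) :
    canonicalTrace Γ (FullGroupCStar.of g : FullGroupCStar Γ) = if g = 1 then 1 else 0 := by
  change ⟪deltaOne Γ, FullGroupCStar.lift (leftRegular Γ)
    (FullGroupCStar.of g : FullGroupCStar Γ) (deltaOne Γ)⟫_ℂ = _
  rw [FullGroupCStar.lift_of]
  unfold deltaOne
  rw [lp.inner_single_left, leftRegular_apply, mul_one, lp.single_apply]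
  by_cases h : g = 1
  · subst h; simp
  · simp [h]

/-! ### States and traces -/

open scoped ComplexOrder in
/-- A tracial state: a positive, unital linear functional with `φ (a b) = φ (b a)`. -/
structure IsTracialState {A : Type*} [Ring A] [StarRing A] [Algebra ℂ A] (φ : A →ₗ[ℂ] ℂ) :
    Prop where
  nonneg : ∀ a, 0 ≤ φ (star a * a)
  map_one : φ 1 = 1
  map_mul_comm : ∀ a b, φ (a * b) = φ (b * a)

/-- The pair `(Γ, Λ)` is tracial rigid: the canonical trace of `C⋆(Γ)` is the only tracial state on
`C⋆(Γ)` that extends the canonical trace of `C⋆(Λ)`. (That it is a tracial state extending it holds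
for every pair.) -/
def TracialRigid {Γ : Type*} [Group Γ] (Λ : Subgroup Γ) : Prop :=
  ∀ τ : FullGroupCStar Γ →ₗ[ℂ] ℂ, IsTracialState τ →
    (∀ a : FullGroupCStar Λ, τ (FullGroupCStar.incl Λ a) = canonicalTrace Λ a) →
    τ = canonicalTrace Γ

/-- A group is icc if every conjugacy class other than that of the identity is infinite. -/
def IsICC (Λ : Type*) [Group Λ] : Prop :=
  ∀ h : Λ, h ≠ 1 → (conjugatesOf h).Infinite

/-! ### Von Neumann algebras of unitary representations -/

section VN

variable {G : Type*} [Group G] {H : Type*} [NormedAddCommGroup H] [InnerProductSpace ℂ H]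
  [CompleteSpace H]

/-- The range of a unitary representation, as a set of operators. -/
def repRange (π : G →* unitary (H →L[ℂ] H)) : Set (H →L[ℂ] H) :=
  Set.range fun g => (π g : H →L[ℂ] H)

theorem star_repRange (π : G →* unitary (H →L[ℂ] H)) : star (repRange π) = repRange π := by
  have key : ∀ x ∈ repRange π, star x ∈ repRange π := by
    rintro _ ⟨g, rfl⟩
    exact ⟨g⁻¹, by simp only [map_inv, ← Unitary.star_eq_inv, Unitary.coe_star]⟩
  ext x
  exact ⟨fun hx => by simpa using key _ (Set.mem_star.mp hx), fun hx => key x hx⟩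

/-- The von Neumann algebra `π(G)''` generated by a unitary representation: the double commutant
of the range. -/
def repVN (π : G →* unitary (H →L[ℂ] H)) : VonNeumannAlgebra H where
  toStarSubalgebra :=
    StarSubalgebra.centralizer ℂ (StarSubalgebra.centralizer ℂ (repRange π) : Set (H →L[ℂ] H))
  centralizer_centralizer' := by
    change Set.centralizer (Set.centralizer
      (StarSubalgebra.centralizer ℂ (StarSubalgebra.centralizer ℂ (repRange π) :
        Set (H →L[ℂ] H)) : Set (H →L[ℂ] H))) =
      (StarSubalgebra.centralizer ℂ (StarSubalgebra.centralizer ℂ (repRange π) :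
        Set (H →L[ℂ] H)) : Set (H →L[ℂ] H))
    rw [StarSubalgebra.coe_centralizer_centralizer, Set.centralizer_centralizer_centralizer]

theorem coe_repVN (π : G →* unitary (H →L[ℂ] H)) :
    (repVN π : Set (H →L[ℂ] H)) = Set.centralizer (Set.centralizer (repRange π)) := by
  have h := StarSubalgebra.coe_centralizer_centralizer ℂ (repRange π)
  rw [star_repRange, Set.union_self] at h
  exact h

theorem mem_repVN (π : G →* unitary (H →L[ℂ] H)) (g : G) :
    (π g : H →L[ℂ] H) ∈ (repVN π).toStarSubalgebra := by
  change (π g : H →L[ℂ] H) ∈ (repVN π : Set (H →L[ℂ] H))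
  rw [coe_repVN]
  exact Set.subset_centralizer_centralizer ⟨g, rfl⟩

/-- A functional on a von Neumann algebra `M` on `H` is normal if it is the restriction to `M` of
a weak-⋆ continuous functional of `B(H)`, i.e. of pairing with a trace class operator
`∑ |ξ_n⟩⟨η_n|`, where `∑ ‖ξ_n‖²` and `∑ ‖η_n‖²` are finite. -/
def IsNormalFunctional (M : VonNeumannAlgebra H) (φ : M.toStarSubalgebra →ₗ[ℂ] ℂ) : Prop :=
  ∃ ξ η : ℕ → H, Summable (fun n => ‖ξ n‖ ^ 2) ∧ Summable (fun n => ‖η n‖ ^ 2) ∧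
    ∀ x : M.toStarSubalgebra, HasSum (fun n => ⟪η n, (x : H →L[ℂ] H) (ξ n)⟫_ℂ) (φ x)

/-- A von Neumann algebra is finite if it has a normal faithful tracial state. -/
def IsFiniteVN (M : VonNeumannAlgebra H) : Prop :=
  ∃ φ : M.toStarSubalgebra →ₗ[ℂ] ℂ, IsTracialState φ ∧ IsNormalFunctional M φ ∧
    ∀ a, φ (star a * a) = 0 → a = 0

/-- The group von Neumann algebra `L(G)`, generated by the left regular representation. -/
def groupVN (G : Type*) [Group G] : VonNeumannAlgebra (EllTwo G) := repVN (leftRegular G)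

/-- The canonical unitary `λ_g` as an element of `L(G)`. -/
def groupVN.of (g : G) : (groupVN G).toStarSubalgebra :=
  ⟨(leftRegular G g : EllTwo G →L[ℂ] EllTwo G), mem_repVN (leftRegular G) g⟩

/-- The unitary representation `π` of `G` extends to an isomorphism `L(G) ≅ π(G)''`: there is a
star isomorphism sending `λ_g` to `π(g)` for all `g`. -/
def ExtendsToGroupVNIso (π : G →* unitary (H →L[ℂ] H)) : Prop :=
  ∃ θ : (groupVN G).toStarSubalgebra ≃⋆ₐ[ℂ] (repVN π).toStarSubalgebra,
    ∀ g : G, (θ (groupVN.of g) : H →L[ℂ] H) = π g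

end VN

end

noncomputable section

open Filter Topology
open scoped ComplexOrder NNReal

/-! ### Order, weak limits and normal functionals on von Neumann algebras -/

/-! Let φ be a faithful normal tracial state of M. Composed with the homomorphism C⋆(Γ) → M induced
by π, it becomes a tracial state τ on C⋆(Γ). The theorem follows once τ is known to be the canonical
trace, that is, once φ(π(g)) = 0 for every g ≠ e.

By rigidity it is enough to know this on Λ. For h ≠ e in Λ, let x_n be the average of λ over 2^n
distinct conjugates of h. The canonical trace of x_n⋆x_n is 2^(-n), while φ(θ(x_n)) = φ(π(h)) for
all n, where θ : L(Λ) ≅ π(Λ)'' is the given isomorphism. By Cauchy–Schwarz, |φ(π(h))|² ≤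
φ(θ(x_n⋆x_n)). If θ were known to be normal, the right side would tend to 0. Here θ is only a
⋆-isomorphism, and `nonpos_of_forall_le_of_geometric` gets the same conclusion from the order
structure alone, by a noncommutative Borel–Cantelli argument: positive contractions of summable
trace have decreasing upper bounds f_m of trace tending to 0. The images θ(f_m) decrease to 0
because θ is an order isomorphism, and normality of φ on the target finishes. This gives
`map_of_eq_zero_of_infinite_conjugates`, and rigidity then gives `map_of_eq_ite`.

It remains to show that a faithful normal trace which is canonical on the group forces M ≅ L(Γ)
(`extendsToGroupVNIso_of_map_of_eq_ite`). The GNS vectors of the π(g) are orthonormal, and they are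
total by the double commutant argument on amplifications. The GNS representation thus becomes a
homomorphism Φ into B(ℓ²(Γ)) with Φ(π(g)) = λ_g. It is injective by faithfulness and takes values in
L(Γ) by approximation in the 2-norm. For surjectivity, a self-adjoint S in L(Γ) is approximated at
δ_e by Φ(b_n) with b_n self-adjoint. The b_n may be unbounded, but their resolvents at -i are
contractions, so a weak limit exists and is mapped by Φ to the resolvent of S. The range of Φ is a
C⋆-algebra, so it then contains S. -/

theorem summable_norm_mul_norm {H : Type*} [NormedAddCommGroup H] {ξ η : ℕ → H}
    (hξ : Summable fun n => ‖ξ n‖ ^ 2)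
    (hη : Summable fun n => ‖η n‖ ^ 2) : Summable fun n => ‖η n‖ * ‖ξ n‖ :=
  (hξ.add hη).of_nonneg_of_le (fun n => by positivity)
    fun n => by nlinarith [sq_nonneg (‖η n‖ - ‖ξ n‖), sq_nonneg (‖η n‖ + ‖ξ n‖)]

theorem norm_inner_apply_le {H : Type*} [NormedAddCommGroup H]
    [InnerProductSpace ℂ H] (x : H →L[ℂ] H) (ξ η : H) {C : ℝ} (hx : ‖x‖ ≤ C) :
    ‖⟪η, x ξ⟫_ℂ‖ ≤ C * (‖η‖ * ‖ξ‖) :=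
  calc ‖⟪η, x ξ⟫_ℂ‖ ≤ ‖η‖ * (‖x‖ * ‖ξ‖) :=
        (norm_inner_le_norm _ _).trans
          (mul_le_mul_of_nonneg_left (x.le_opNorm ξ) (norm_nonneg _))
    _ = ‖x‖ * (‖η‖ * ‖ξ‖) := by ring
    _ ≤ C * (‖η‖ * ‖ξ‖) := by gcongr

section VonNeumann

variable {H : Type*} [NormedAddCommGroup H] [InnerProductSpace ℂ H] [CompleteSpace H]

namespace VonNeumannAlgebra

variable (M : VonNeumannAlgebra H)

/-- The double commutant condition in the form that passes to functional calculus and to weak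
limits. -/
theorem mem_iff_forall_commute {M : VonNeumannAlgebra H} {x : H →L[ℂ] H} :
    x ∈ M.toStarSubalgebra ↔
      ∀ z ∈ Set.centralizer (M : Set (H →L[ℂ] H)), Commute x z := by
  change x ∈ (M : Set (H →L[ℂ] H)) ↔ _
  conv_lhs => rw [← M.centralizer_centralizer]
  exact ⟨fun h z hz => (h z hz).symm, fun h z hz => (h z hz).symm⟩

/-- Commutants are norm closed. This makes M a C⋆-algebra in its own right, with its functional
calculus and contractive homomorphisms. -/
instance isClosed_toStarSubalgebra : IsClosed (M.toStarSubalgebra : Set (H →L[ℂ] H)) := by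
  rw [coe_toStarSubalgebra, ← M.centralizer_centralizer]
  exact Set.isClosed_centralizer _

instance starOrderedRing_toStarSubalgebra : StarOrderedRing M.toStarSubalgebra := by
  refine StarOrderedRing.of_nonneg_iff' (fun {x y} h z => ?_) fun x => ⟨fun h => ?_, ?_⟩
  · exact add_le_add_right (show (x : H →L[ℂ] H) ≤ y from h) (z : H →L[ℂ] H)
  · have h0 : 0 ≤ (x : H →L[ℂ] H) := h
    -- The square root taken in B(H) commutes with everything that commutes with x, so it already
    -- lies in M.
    have hm : CFC.sqrt (x : H →L[ℂ] H) ∈ M.toStarSubalgebra :=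
      mem_iff_forall_commute.mpr fun z hz =>
        Commute.cfcₙ_nnreal (mem_iff_forall_commute.mp x.2 z hz) _
    refine ⟨⟨_, hm⟩, Subtype.ext ?_⟩
    change (x : H →L[ℂ] H) = star (CFC.sqrt (x : H →L[ℂ] H)) * CFC.sqrt (x : H →L[ℂ] H)
    rw [(IsSelfAdjoint.of_nonneg (CFC.sqrt_nonneg _)).star_eq, CFC.sqrt_mul_sqrt_self _ h0]
  · rintro ⟨s, rfl⟩
    exact star_mul_self_nonneg (s : H →L[ℂ] H)

variable {M}

/-- Convergence of a sequence in a von Neumann algebra in the weak operator topology. -/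
def WeakTendsto (a : ℕ → M.toStarSubalgebra) (l : Filter ℕ) (y : M.toStarSubalgebra) : Prop :=
  ∀ ξ η : H, Tendsto (fun n => ⟪ξ, (a n : H →L[ℂ] H) η⟫_ℂ) l (𝓝 ⟪ξ, (y : H →L[ℂ] H) η⟫_ℂ)

/-- Bounded sequences in a von Neumann algebra converge weakly along ultrafilters. -/
theorem exists_weakTendsto (l : Ultrafilter ℕ) {a : ℕ → M.toStarSubalgebra} {C : ℝ}
    (ha : ∀ n, ‖a n‖ ≤ C) : ∃ y, WeakTendsto a l y := by
  have hC : 0 ≤ C := (norm_nonneg _).trans (ha 0)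
  have hb : ∀ (ξ η : H) n, ‖⟪(a n : H →L[ℂ] H) ξ, η⟫_ℂ‖ ≤ C * ‖ξ‖ * ‖η‖ := fun ξ η n =>
    (norm_inner_le_norm _ _).trans <| mul_le_mul_of_nonneg_right
      (((a n : H →L[ℂ] H).le_opNorm ξ).trans
        (mul_le_mul_of_nonneg_right (ha n) (norm_nonneg _))) (norm_nonneg _)
  have hlim : ∀ ξ η : H, ∃ z : ℂ, ‖z‖ ≤ C * ‖ξ‖ * ‖η‖ ∧
      Tendsto (fun n => ⟪(a n : H →L[ℂ] H) ξ, η⟫_ℂ) l (𝓝 z) := by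
    intro ξ η
    have hK := isCompact_closedBall (0 : ℂ) (C * ‖ξ‖ * ‖η‖)
    obtain ⟨z, hz, h⟩ := hK.ultrafilter_le_nhds
      (l.map fun n => ⟪(a n : H →L[ℂ] H) ξ, η⟫_ℂ) (by
        rw [le_principal_iff]
        rw [Ultrafilter.mem_coe, Ultrafilter.mem_map]
        exact Filter.univ_mem' fun n => by simpa using hb ξ η n)
    exact ⟨z, by simpa using hz, h⟩
  choose B hB hBl using hlim
  -- The limits of the matrix coefficients form a bounded sesquilinear form, which is represented by
  -- an operator.
  let B' : H →L⋆[ℂ] H →L[ℂ] ℂ := LinearMap.mkContinuous₂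
    (LinearMap.mk₂'ₛₗ (starRingEnd ℂ) (RingHom.id ℂ) B
      (fun x y z => tendsto_nhds_unique (hBl _ _)
        (by simpa [inner_add_left] using (hBl x z).add (hBl y z)))
      (fun c x z => tendsto_nhds_unique (hBl _ _)
        (by simpa [inner_smul_left, mul_comm] using (hBl x z).const_mul (starRingEnd ℂ c)))
      (fun x y z => tendsto_nhds_unique (hBl _ _)
        (by simpa [inner_add_right] using (hBl x y).add (hBl x z)))
      (fun c x z => tendsto_nhds_unique (hBl _ _)
        (by simpa [inner_smul_right] using (hBl x z).const_mul c))) C hB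
  let y : H →L[ℂ] H := InnerProductSpace.continuousLinearMapOfBilin B'
  have hy : ∀ ξ η : H, ⟪y ξ, η⟫_ℂ = B ξ η := fun ξ η =>
    InnerProductSpace.continuousLinearMapOfBilin_apply B' ξ η
  have hyl : ∀ ξ η : H, Tendsto (fun n => ⟪ξ, (a n : H →L[ℂ] H) η⟫_ℂ) l (𝓝 ⟪ξ, y η⟫_ℂ) := by
    intro ξ η
    have h := (continuous_star.tendsto _).comp (hBl η ξ)
    rw [← hy] at h
    simpa only [Function.comp_def, ← starRingEnd_apply, inner_conj_symm] using h
  have hm : y ∈ M.toStarSubalgebra := by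
    refine mem_iff_forall_commute.mpr fun z hz => ?_
    refine ContinuousLinearMap.ext fun η => ext_inner_left ℂ fun ξ => ?_
    have h1 := hyl ξ (z η)
    have h2 := hyl (ContinuousLinearMap.adjoint z ξ) η
    simp only [ContinuousLinearMap.adjoint_inner_left] at h2
    refine tendsto_nhds_unique h1 (h2.congr fun n => ?_)
    have h3 : Commute (a n : H →L[ℂ] H) z := mem_iff_forall_commute.mp (a n).2 z hz
    exact congrArg (fun T : H →L[ℂ] H => ⟪ξ, T η⟫_ℂ) h3.eq.symm
  exact ⟨⟨y, hm⟩, hyl⟩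

theorem WeakTendsto.const_mul {l : Filter ℕ} {a : ℕ → M.toStarSubalgebra}
    {y : M.toStarSubalgebra} (h : WeakTendsto a l y) (b : M.toStarSubalgebra) :
    WeakTendsto (fun n => b * a n) l (b * y) := fun ξ η => by
  have h2 := h (ContinuousLinearMap.adjoint (b : H →L[ℂ] H) ξ) η
  simp only [ContinuousLinearMap.adjoint_inner_left] at h2
  exact h2

theorem WeakTendsto.nonneg {l : Filter ℕ} [l.NeBot] {a : ℕ → M.toStarSubalgebra}
    {y : M.toStarSubalgebra} (h : WeakTendsto a l y) (ha : ∀ᶠ n in l, 0 ≤ a n) : 0 ≤ y := by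
  change (0 : H →L[ℂ] H) ≤ y
  rw [ContinuousLinearMap.nonneg_iff_isPositive, ContinuousLinearMap.isPositive_iff_complex]
  intro ξ
  have h1 : (0 : ℂ) ≤ ⟪ξ, (y : H →L[ℂ] H) ξ⟫_ℂ := by
    refine ge_of_tendsto (h ξ ξ) (ha.mono fun n hn => ?_)
    have h2 : (0 : H →L[ℂ] H) ≤ a n := hn
    rw [ContinuousLinearMap.nonneg_iff_isPositive] at h2
    exact h2.inner_nonneg_right ξ
  have h2 : (0 : ℂ) ≤ ⟪(y : H →L[ℂ] H) ξ, ξ⟫_ℂ := by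
    rw [← inner_conj_symm]
    exact star_nonneg_iff.mpr h1
  have h3 := RCLike.nonneg_iff.mp h2
  exact ⟨RCLike.ext (by simp) (by simpa using h3.2.symm), h3.1⟩

theorem WeakTendsto.sub {l : Filter ℕ} {a b : ℕ → M.toStarSubalgebra}
    {y z : M.toStarSubalgebra} (h : WeakTendsto a l y) (h' : WeakTendsto b l z) :
    WeakTendsto (fun n => a n - b n) l (y - z) := fun ξ η => by
  have h2 := (h ξ η).sub (h' ξ η)
  simp only [← inner_sub_right] at h2
  exact h2

theorem weakTendsto_const (l : Filter ℕ) (b : M.toStarSubalgebra) :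
    WeakTendsto (fun _ => b) l b := fun _ _ => tendsto_const_nhds

theorem WeakTendsto.le {l : Filter ℕ} [l.NeBot] {a b : ℕ → M.toStarSubalgebra}
    {y z : M.toStarSubalgebra} (h : WeakTendsto a l y) (h' : WeakTendsto b l z)
    (hab : ∀ᶠ n in l, a n ≤ b n) : y ≤ z :=
  sub_nonneg.mp ((h'.sub h).nonneg (hab.mono fun _ hn => sub_nonneg.mpr hn))

end VonNeumannAlgebra

namespace IsNormalFunctional

variable {M : VonNeumannAlgebra H} {φ : M.toStarSubalgebra →ₗ[ℂ] ℂ}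

theorem exists_bound (h : IsNormalFunctional M φ) : ∃ C, ∀ x, ‖φ x‖ ≤ C * ‖x‖ := by
  obtain ⟨ξ, η, hξ, hη, hφ⟩ := h
  refine ⟨∑' n, ‖η n‖ * ‖ξ n‖, fun x => ?_⟩
  rw [← (hφ x).tsum_eq, mul_comm, ← tsum_mul_left]
  exact tsum_of_norm_bounded ((summable_norm_mul_norm hξ hη).mul_left _).hasSum
    fun n => norm_inner_apply_le _ _ _ le_rfl

theorem continuous (h : IsNormalFunctional M φ) : Continuous φ := by
  obtain ⟨C, hC⟩ := h.exists_bound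
  exact (φ.mkContinuous C hC).continuous

/-- Dominated convergence in the defining series; the uniform bound on the sequence provides the
dominating terms. -/
theorem tendsto (h : IsNormalFunctional M φ) {l : Filter ℕ} {a : ℕ → M.toStarSubalgebra}
    {y : M.toStarSubalgebra} {C : ℝ} (ha : ∀ n, ‖a n‖ ≤ C)
    (hy : VonNeumannAlgebra.WeakTendsto a l y) : Tendsto (fun n => φ (a n)) l (𝓝 (φ y)) := by
  obtain ⟨ξ, η, hξ, hη, hφ⟩ := h
  simp only [← fun x => (hφ x).tsum_eq]
  exact tendsto_tsum_of_dominated_convergence ((summable_norm_mul_norm hξ hη).mul_left C)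
    (fun k => hy _ _) (.of_forall fun n k => norm_inner_apply_le _ _ _ (ha n))

end IsNormalFunctional

namespace IsTracialState

theorem map_nonneg {M : VonNeumannAlgebra H} {φ : M.toStarSubalgebra →ₗ[ℂ] ℂ}
    (h : IsTracialState φ) {x : M.toStarSubalgebra} (hx : 0 ≤ x) : 0 ≤ φ x := by
  obtain ⟨b, rfl⟩ := CStarAlgebra.nonneg_iff_eq_star_mul_self.mp hx
  exact h.nonneg b

end IsTracialState

end VonNeumann

/-! ### Comparison of normal functionals through an isomorphism -/

section Cutoff

variable {A : Type*} [CStarAlgebra A] [PartialOrder A] [StarOrderedRing A]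

/-- The operator monotone cutoff `c ↦ 1 - (1 + c)⁻¹`. -/
def cutoff (c : A) : A := cfcₙ (fun x : ℝ≥0 => 1 - (1 + x)⁻¹) c

/-- No sign hypothesis is needed: the functional calculus over `ℝ≥0` returns 0 on elements that are
not positive. -/
theorem cutoff_nonneg (c : A) : 0 ≤ cutoff c := cfcₙ_nonneg_of_predicate

theorem norm_cutoff_le (c : A) : ‖cutoff c‖ ≤ 1 :=
  (norm_cfcₙ_one_sub_one_add_inv_lt_one c).le

theorem cutoff_mono {c d : A} (hc : 0 ≤ c) (h : c ≤ d) : cutoff c ≤ cutoff d :=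
  CFC.monotoneOn_one_sub_one_add_inv hc (hc.trans h) h

theorem continuous_cutoff_fun : Continuous fun x : ℝ≥0 => 1 - (1 + x)⁻¹ :=
  continuous_const.sub ((continuous_const.add continuous_id).inv₀ fun x => by
    exact (add_pos_of_pos_of_nonneg one_pos zero_le).ne')

theorem cutoff_le {c : A} (hc : 0 ≤ c) : cutoff c ≤ c := by
  conv_rhs => rw [← cfcₙ_id' ℝ≥0 c]
  refine cfcₙ_mono (fun x _ => ?_) continuous_cutoff_fun.continuousOn continuous_id.continuousOn
  rw [tsub_le_iff_right, ← NNReal.coe_le_coe]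
  have hx : (0 : ℝ) ≤ x := x.2
  push_cast
  have h : (0 : ℝ) < 1 + x := by positivity
  have h2 : (1 + (x : ℝ)) * (1 + (x : ℝ))⁻¹ = 1 := mul_inv_cancel₀ h.ne'
  have h3 : 0 < (1 + (x : ℝ))⁻¹ := inv_pos.mpr h
  nlinarith

/-- The cutoff function is x/(1 + x), and 1 + x ≤ 2 on the spectrum of a positive contraction. -/
theorem le_two_smul_cutoff {c : A} (hc : 0 ≤ c) (h1 : ‖c‖ ≤ 1) :
    c ≤ cutoff c + cutoff c := by
  unfold cutoff
  rw [← cfcₙ_add (a := c) (f := fun x : ℝ≥0 => 1 - (1 + x)⁻¹) (g := fun x => 1 - (1 + x)⁻¹)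
    (hf := continuous_cutoff_fun.continuousOn) (hg := continuous_cutoff_fun.continuousOn)
    (hf0 := by simp) (hg0 := by simp)]
  conv_lhs => rw [← cfcₙ_id' ℝ≥0 c]
  refine cfcₙ_mono (fun x hx => ?_) continuous_id.continuousOn
    (continuous_cutoff_fun.add continuous_cutoff_fun).continuousOn
  have hx1 : x ≤ 1 := (CStarAlgebra.le_nnnorm_of_mem_quasispectrum hx).trans h1
  -- Subtraction in `ℝ≥0` is truncated; this bound lets it pass to the reals.
  have h0 : (1 + x)⁻¹ ≤ 1 := inv_le_one_of_one_le₀ (by simp)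
  rw [← NNReal.coe_le_coe]
  push_cast [NNReal.coe_sub h0]
  have hx0 : (0 : ℝ) ≤ x := x.2
  have hx1' : (x : ℝ) ≤ 1 := hx1
  have h : (0 : ℝ) < 1 + x := by positivity
  have h2 : (1 + (x : ℝ)) * (1 + (x : ℝ))⁻¹ = 1 := mul_inv_cancel₀ h.ne'
  have h3 : 0 < (1 + (x : ℝ))⁻¹ := inv_pos.mpr h
  nlinarith [mul_nonneg hx0 (sub_nonneg.mpr hx1'), mul_nonneg hx0 h3.le]

end Cutoff

section Comparison

variable {H : Type*} [NormedAddCommGroup H] [InnerProductSpace ℂ H] [CompleteSpace H]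
  {K : Type*} [NormedAddCommGroup K] [InnerProductSpace ℂ K] [CompleteSpace K]

theorem re_map_le_of_nonneg {M : VonNeumannAlgebra H} {φ : M.toStarSubalgebra →ₗ[ℂ] ℂ}
    (h : ∀ a, 0 ≤ φ (star a * a)) {x y : M.toStarSubalgebra} (hxy : x ≤ y) :
    (φ x).re ≤ (φ y).re := by
  obtain ⟨b, hb⟩ := CStarAlgebra.nonneg_iff_eq_star_mul_self.mp (sub_nonneg.mpr hxy)
  have h1 := (RCLike.nonneg_iff.mp (h b)).1
  rw [← hb, map_sub, map_sub] at h1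
  exact sub_nonneg.mp h1

/-- If the values of a faithful normal positive functional `τ` on a sequence of positive
contractions decay geometrically, then the images of the sequence under an isomorphism cannot be
bounded below by a positive number in a normal positive functional `φ`. -/
theorem nonpos_of_forall_le_of_geometric {M : VonNeumannAlgebra H} {N : VonNeumannAlgebra K}
    (θ : M.toStarSubalgebra ≃⋆ₐ[ℂ] N.toStarSubalgebra)
    {τ : M.toStarSubalgebra →ₗ[ℂ] ℂ} (hτ : ∀ a, 0 ≤ τ (star a * a))
    (hτn : IsNormalFunctional M τ) (hτf : ∀ a, τ (star a * a) = 0 → a = 0)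
    {φ : N.toStarSubalgebra →ₗ[ℂ] ℂ} (hφ : ∀ a, 0 ≤ φ (star a * a))
    (hφn : IsNormalFunctional N φ)
    {a : ℕ → M.toStarSubalgebra} (ha : ∀ n, 0 ≤ a n) (ha1 : ∀ n, ‖a n‖ ≤ 1)
    (hτa : ∀ n, (τ (a n)).re ≤ (1 / 2) ^ n) {δ : ℝ} (hδ : ∀ n, δ ≤ (φ (θ (a n))).re) :
    δ ≤ 0 := by
  let s : ℕ → ℕ → M.toStarSubalgebra := fun m k => ∑ i ∈ Finset.Ico m k, a i
  have hs0 : ∀ m k, 0 ≤ s m k := fun m k => Finset.sum_nonneg fun i _ => ha i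
  let l : Ultrafilter ℕ := hyperfilter ℕ
  have hl : ∀ m : ℕ, ∀ᶠ k in (l : Filter ℕ), m ≤ k := fun m =>
    Nat.hyperfilter_le_atTop (eventually_ge_atTop m)
  -- `f m` stands in for the join of the `a i` with i ≥ m. The partial sums may be unbounded; their
  -- cutoffs are contractions, and operator monotonicity of the cutoff keeps the comparison with
  -- each summand.
  choose f hf using fun m => VonNeumannAlgebra.exists_weakTendsto l
    (a := fun k => cutoff (s m k)) (C := 1) fun k => norm_cutoff_le _
  have hf0 : ∀ m, 0 ≤ f m := fun m => (hf m).nonneg (.of_forall fun k => cutoff_nonneg _)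
  have hf1 : ∀ m, ‖f m‖ ≤ 1 := fun m => by
    rw [CStarAlgebra.norm_le_one_iff_of_nonneg _ (hf0 m)]
    refine (hf m).le (VonNeumannAlgebra.weakTendsto_const _ _) (.of_forall fun k => ?_)
    exact (CStarAlgebra.norm_le_one_iff_of_nonneg _ (cutoff_nonneg _)).mp (norm_cutoff_le _)
  have hfa : ∀ m, cutoff (a m) ≤ f m := fun m =>
    (VonNeumannAlgebra.weakTendsto_const _ _).le (hf m) ((hl (m + 1)).mono fun k hk =>
      cutoff_mono (ha m) (Finset.single_le_sum (f := a) (fun i _ => ha i)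
        (Finset.mem_Ico.mpr ⟨le_rfl, hk⟩)))
  have hanti : ∀ m m', m ≤ m' → f m' ≤ f m := fun m m' h =>
    (hf m').le (hf m) (.of_forall fun k => cutoff_mono (hs0 _ _)
      (Finset.sum_le_sum_of_subset_of_nonneg (Finset.Ico_subset_Ico_left h) fun i _ _ => ha i))
  -- The cutoff of a partial sum lies below the sum, whose trace is bounded by a geometric tail;
  -- normality of τ carries the bound to the limit.
  have hτf2 : ∀ m, (τ (f m)).re ≤ 2 * (1 / 2) ^ m := fun m => by
    have h1 := (Complex.continuous_re.tendsto _).comp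
      (hτn.tendsto (fun k => norm_cutoff_le (s m k)) (hf m))
    refine le_of_tendsto h1 (.of_forall fun k => ?_)
    refine (re_map_le_of_nonneg hτ (cutoff_le (hs0 m k))).trans ?_
    rw [map_sum, Complex.re_sum]
    refine (Finset.sum_le_sum fun i _ => hτa i).trans ?_
    calc ∑ i ∈ Finset.Ico m k, (1 / 2 : ℝ) ^ i ≤ (1 / 2) ^ m / (1 - 1 / 2) :=
          geom_sum_Ico_le_of_lt_one (by norm_num) (by norm_num)
      _ = 2 * (1 / 2) ^ m := by ring
  have hθ1 : ∀ m, ‖θ (f m)‖ ≤ 1 := fun m =>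
    (NonUnitalStarAlgHom.norm_apply_le θ (f m)).trans (hf1 m)
  obtain ⟨e, he⟩ := VonNeumannAlgebra.exists_weakTendsto l hθ1
  have hθmono : ∀ {x y}, x ≤ y → θ x ≤ θ y := fun h => OrderHomClass.mono θ h
  have he0 : 0 ≤ e := he.nonneg (.of_forall fun m => by simpa using hθmono (hf0 m))
  -- Only positivity of θ and of its inverse is used, so θ need not be normal. The pulled-back limit
  -- lies below every `f m`, and its τ-value vanishes.
  have hele : ∀ m, θ.symm e ≤ f m := fun m => by
    have h : e ≤ θ (f m) := he.le (VonNeumannAlgebra.weakTendsto_const _ _)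
      ((hl m).mono fun m' hm => hθmono (hanti m m' hm))
    simpa using OrderHomClass.mono θ.symm h
  have hez : e = 0 := by
    have h0 : 0 ≤ θ.symm e := by simpa using OrderHomClass.mono θ.symm he0
    obtain ⟨b, hb⟩ := CStarAlgebra.nonneg_iff_eq_star_mul_self.mp h0
    have hp := RCLike.nonneg_iff.mp (hτ b)
    have hle : (τ (star b * b)).re ≤ 0 := by
      have hlim : Tendsto (fun m : ℕ => 2 * (1 / 2 : ℝ) ^ m) atTop (𝓝 (2 * 0)) :=
        (tendsto_pow_atTop_nhds_zero_of_lt_one (by norm_num) (by norm_num)).const_mul 2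
      rw [mul_zero] at hlim
      refine ge_of_tendsto' hlim fun m => ?_
      rw [← hb]
      exact (re_map_le_of_nonneg hτ (hele m)).trans (hτf2 m)
    have hb0 : b = 0 := hτf b (Complex.ext (le_antisymm hle hp.1) hp.2)
    rw [hb0, mul_zero] at hb
    simpa using congrArg θ hb
  have hφ0 := (Complex.continuous_re.tendsto _).comp (hφn.tendsto hθ1 he)
  rw [hez, map_zero, Complex.zero_re] at hφ0
  have h2 := hφ0.add hφ0
  rw [add_zero] at h2
  refine ge_of_tendsto h2 (.of_forall fun m => (hδ m).trans ?_)
  have h3 : a m ≤ f m + f m := (le_two_smul_cutoff (ha m) (ha1 m)).trans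
    (add_le_add (hfa m) (hfa m))
  simpa using re_map_le_of_nonneg hφ (hθmono h3)

end Comparison

/-! ### The group von Neumann algebra -/

section GroupVN

variable {G : Type*}

/-- The basis vector `δ_g` of `ℓ²(G)`. -/
def delta (g : G) : EllTwo G :=
  haveI := Classical.decEq G
  lp.single 2 g (1 : ℂ)

theorem inner_delta_left (g : G) (ξ : EllTwo G) : ⟪delta g, ξ⟫_ℂ = ξ g := by
  let _ := Classical.decEq G
  exact (lp.inner_single_left g (1 : ℂ) ξ).trans
    (show ξ g * (starRingEnd ℂ) 1 = ξ g by rw [map_one, mul_one])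

open scoped Classical in
theorem delta_apply (g h : G) : delta g h = if h = g then 1 else 0 := by
  unfold delta
  rw [lp.single_apply]
  by_cases hg : h = g
  · subst hg; simp
  · simp [hg]

theorem orthonormal_delta : Orthonormal ℂ (delta : G → EllTwo G) := by
  classical
  rw [orthonormal_iff_ite]
  intro g h
  rw [inner_delta_left, delta_apply]

theorem ext_inner_delta {ξ η : EllTwo G} (h : ∀ g, ⟪delta g, ξ⟫_ℂ = ⟪delta g, η⟫_ℂ) : ξ = η :=
  lp.ext <| funext fun g => by simpa only [inner_delta_left] using h g

theorem ext_delta {F : Type*} [NormedAddCommGroup F] [NormedSpace ℂ F] {S T : EllTwo G →L[ℂ] F}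
    (h : ∀ g, S (delta g) = T (delta g)) : S = T := by
  let _ := Classical.decEq G
  refine lp.ext_continuousLinearMap (by simp) fun g => ContinuousLinearMap.ext_ring ?_
  change S (lp.single 2 g 1) = T (lp.single 2 g 1)
  exact h g

variable [Group G]

theorem leftRegular_delta (g h : G) :
    (leftRegular G g : EllTwo G →L[ℂ] EllTwo G) (delta h) = delta (g * h) := by
  classical
  refine lp.ext <| funext fun k => ?_
  rw [leftRegular_apply, delta_apply, delta_apply]
  simp only [inv_mul_eq_iff_eq_mul]

/-- Right translation by `g` on `ℓ²(G)`: `(ρ_g ξ)(h) = ξ(h g)`. -/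
def rightTranslate (g : G) : EllTwo G →ₗᵢ[ℂ] EllTwo G where
  toFun ξ := ⟨fun h => ξ (h * g), by
    have hξ := (memℓp_gen_iff (by norm_num)).mp (lp.memℓp ξ)
    exact (memℓp_gen_iff (by norm_num)).mpr ((Equiv.mulRight g).summable_iff.mpr hξ)⟩
  map_add' ξ η := rfl
  map_smul' c ξ := rfl
  norm_map' ξ := by
    rw [lp.norm_eq_tsum_rpow (by norm_num), lp.norm_eq_tsum_rpow (by norm_num)]
    congr 1
    exact (Equiv.mulRight g).tsum_eq (fun h => ‖ξ h‖ ^ (2 : ENNReal).toReal)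

theorem rightTranslate_apply (g : G) (ξ : EllTwo G) (h : G) : rightTranslate g ξ h = ξ (h * g) :=
  rfl

theorem rightTranslate_inv_delta (g : G) : rightTranslate g⁻¹ (delta 1) = delta g := by
  classical
  refine lp.ext <| funext fun k => ?_
  rw [rightTranslate_apply, delta_apply, delta_apply]
  simp only [mul_inv_eq_one]

namespace groupVN

variable {T : EllTwo G →L[ℂ] EllTwo G}

/-- Left and right translations commute, so right translations lie in the commutant of L(G). -/
theorem apply_rightTranslate (hT : T ∈ (groupVN G).toStarSubalgebra) (g : G) (ξ : EllTwo G) :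
    T (rightTranslate g ξ) = rightTranslate g (T ξ) := by
  have h : T ∈ Set.centralizer (Set.centralizer (repRange (leftRegular G))) := by
    rw [← coe_repVN]; exact hT
  have hR : (rightTranslate g).toContinuousLinearMap ∈
      Set.centralizer (repRange (leftRegular G)) := by
    rintro _ ⟨k, rfl⟩
    refine ContinuousLinearMap.ext fun ξ => lp.ext <| funext fun h => ?_
    change ξ (k⁻¹ * h * g) = ξ (k⁻¹ * (h * g))
    rw [mul_assoc]
  exact (congrArg (fun S : EllTwo G →L[ℂ] EllTwo G => S ξ) (h _ hR)).symm

theorem apply_delta (hT : T ∈ (groupVN G).toStarSubalgebra) (g : G) :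
    T (delta g) = rightTranslate g⁻¹ (T (delta 1)) := by
  rw [← apply_rightTranslate hT, rightTranslate_inv_delta]

/-- δ_e is separating for L(G): right translations carry it to every basis vector and commute with
both operators. -/
theorem eq_of_apply_delta_one {S : EllTwo G →L[ℂ] EllTwo G}
    (hS : S ∈ (groupVN G).toStarSubalgebra) (hT : T ∈ (groupVN G).toStarSubalgebra)
    (h : S (delta 1) = T (delta 1)) : S = T :=
  ext_delta fun g => by rw [apply_delta hS, apply_delta hT, h]

/-- The coefficient of T⋆δ_e at g is the conjugate of that of Tδ_e at g⁻¹. This is the traciality of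
the vector functional of δ_e, in the form needed later. -/
theorem norm_star_apply_delta_one (hT : T ∈ (groupVN G).toStarSubalgebra) :
    ‖star T (delta 1)‖ = ‖T (delta 1)‖ := by
  have key : ∀ g, ‖star T (delta 1) g‖ = ‖T (delta 1) g⁻¹‖ := fun g => by
    rw [← inner_delta_left, ContinuousLinearMap.star_eq_adjoint,
      ContinuousLinearMap.adjoint_inner_right, norm_inner_symm, apply_delta hT, inner_delta_left,
      rightTranslate_apply, one_mul]
  rw [lp.norm_eq_tsum_rpow (by norm_num), lp.norm_eq_tsum_rpow (by norm_num)]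
  congr 1
  simp only [key]
  exact (Equiv.inv G).tsum_eq (fun h => ‖T (delta 1) h‖ ^ (2 : ENNReal).toReal)

/-- The vector functional of `δ_e` on `L(G)`. -/
def vectorTrace (G : Type*) [Group G] : (groupVN G).toStarSubalgebra →ₗ[ℂ] ℂ where
  toFun x := ⟪delta 1, (x : EllTwo G →L[ℂ] EllTwo G) (delta 1)⟫_ℂ
  map_add' _ _ := inner_add_right _ _ _
  map_smul' _ _ := inner_smul_right _ _ _

theorem vectorTrace_star_mul_self (x : (groupVN G).toStarSubalgebra) :
    vectorTrace G (star x * x) = (‖(x : EllTwo G →L[ℂ] EllTwo G) (delta 1)‖ ^ 2 : ℝ) := by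
  change ⟪delta 1, ContinuousLinearMap.adjoint (x : EllTwo G →L[ℂ] EllTwo G)
    ((x : EllTwo G →L[ℂ] EllTwo G) (delta 1))⟫_ℂ = _
  rw [ContinuousLinearMap.adjoint_inner_right, inner_self_eq_norm_sq_to_K]
  simp

theorem vectorTrace_nonneg (x : (groupVN G).toStarSubalgebra) :
    0 ≤ vectorTrace G (star x * x) := by
  rw [vectorTrace_star_mul_self]
  exact Complex.zero_le_real.mpr (sq_nonneg _)

theorem vectorTrace_faithful (x : (groupVN G).toStarSubalgebra)
    (h : vectorTrace G (star x * x) = 0) : x = 0 := by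
  rw [vectorTrace_star_mul_self] at h
  have h1 : (x : EllTwo G →L[ℂ] EllTwo G) (delta 1) = 0 := by simpa using h
  exact Subtype.ext (eq_of_apply_delta_one x.2 (zero_mem _) (by rw [h1]; rfl))

theorem isNormalFunctional_vectorTrace : IsNormalFunctional (groupVN G) (vectorTrace G) := by
  have hs : Summable fun n : ℕ => ‖(Pi.single 0 (delta 1) : ℕ → EllTwo G) n‖ ^ 2 :=
    summable_of_ne_finset_zero (s := {0}) fun n hn => by
      have : n ≠ 0 := by simpa using hn
      simp [this]
  refine ⟨Pi.single 0 (delta 1), Pi.single 0 (delta 1), hs, hs, fun x => ?_⟩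
  have h := hasSum_single (f := fun n : ℕ => ⟪(Pi.single 0 (delta 1) : ℕ → EllTwo G) n,
    (x : EllTwo G →L[ℂ] EllTwo G) ((Pi.single 0 (delta 1) : ℕ → EllTwo G) n)⟫_ℂ) 0
    fun n hn => by simp [hn]
  rw [Pi.single_eq_same] at h
  exact h

theorem norm_of_le (g : G) : ‖of g‖ ≤ 1 := by
  change ‖(leftRegular G g : EllTwo G →L[ℂ] EllTwo G)‖ ≤ 1
  exact ContinuousLinearMap.opNorm_le_bound _ zero_le_one fun ξ => by
    rw [one_mul]
    exact ((leftTranslateEquiv g).norm_map ξ).le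

end groupVN

end GroupVN

/-! ### Cauchy–Schwarz for tracial states -/

namespace IsTracialState

variable {H : Type*} [NormedAddCommGroup H] [InnerProductSpace ℂ H] [CompleteSpace H]
  {M : VonNeumannAlgebra H} {φ : M.toStarSubalgebra →ₗ[ℂ] ℂ}

/-- A tracial state as a positive linear map. -/
def toPositive (h : IsTracialState φ) : M.toStarSubalgebra →ₚ[ℂ] ℂ :=
  PositiveLinearMap.mk₀ φ fun _ => h.map_nonneg

theorem toPositive_apply (h : IsTracialState φ) (x : M.toStarSubalgebra) :
    h.toPositive x = φ x := rfl

theorem norm_sq_le (h : IsTracialState φ) (x : M.toStarSubalgebra) :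
    ‖φ x‖ ^ 2 ≤ (φ (star x * x)).re := by
  have h1 := norm_inner_le_norm (𝕜 := ℂ) (h.toPositive.toPreGNS 1) (h.toPositive.toPreGNS x)
  have h2 : ∀ y, ‖h.toPositive.toPreGNS y‖ ^ 2 = (φ (star y * y)).re := fun y => by
    have := congrArg Complex.re (h.toPositive.preGNS_norm_sq (h.toPositive.toPreGNS y))
    simpa [← Complex.ofReal_pow, toPositive_apply] using this
  rw [h.toPositive.preGNS_inner_def] at h1
  simp only [PositiveLinearMap.ofPreGNS_toPreGNS, star_one, one_mul, toPositive_apply] at h1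
  have h3 : ‖h.toPositive.toPreGNS 1‖ ^ 2 = 1 := by rw [h2, star_one, one_mul, h.map_one]; rfl
  calc ‖φ x‖ ^ 2 ≤ (‖h.toPositive.toPreGNS 1‖ * ‖h.toPositive.toPreGNS x‖) ^ 2 := by gcongr
    _ = _ := by rw [mul_pow, h3, one_mul, h2]

end IsTracialState

/-! ### Vanishing of normal traces at infinite conjugacy classes -/

section ICC

variable {G : Type*} [Group G] {H : Type*} [NormedAddCommGroup H] [InnerProductSpace ℂ H]
  [CompleteSpace H]

/-- The unitary `π g` as an element of `π(G)''`. -/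
def repVN.of (π : G →* unitary (H →L[ℂ] H)) (g : G) : (repVN π).toStarSubalgebra :=
  ⟨π g, mem_repVN π g⟩

theorem repVN.of_mul (π : G →* unitary (H →L[ℂ] H)) (g h : G) :
    repVN.of π (g * h) = repVN.of π g * repVN.of π h :=
  Subtype.ext (by simp [repVN.of])

theorem repVN.of_one (π : G →* unitary (H →L[ℂ] H)) : repVN.of π 1 = 1 :=
  Subtype.ext (by simp [repVN.of])

theorem repVN.star_of (π : G →* unitary (H →L[ℂ] H)) (g : G) :
    star (repVN.of π g) = repVN.of π g⁻¹ :=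
  Subtype.ext (by
    change star (π g : H →L[ℂ] H) = (π g⁻¹ : H →L[ℂ] H)
    rw [map_inv, ← Unitary.star_eq_inv, Unitary.coe_star])

theorem IsTracialState.map_of_conj {π : G →* unitary (H →L[ℂ] H)}
    {φ : (repVN π).toStarSubalgebra →ₗ[ℂ] ℂ} (hφ : IsTracialState φ) {g h : G}
    (hgh : IsConj g h) : φ (repVN.of π h) = φ (repVN.of π g) := by
  obtain ⟨c, rfl⟩ := isConj_iff.mp hgh
  rw [repVN.of_mul, hφ.map_mul_comm, ← repVN.of_mul, ← mul_assoc, inv_mul_cancel, one_mul]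

/-- If `L(G) ≅ π(G)''` and `h` has infinite conjugacy class, then normal tracial states of
`π(G)''` vanish at `π h`. -/
theorem map_of_eq_zero_of_infinite_conjugates {π : G →* unitary (H →L[ℂ] H)}
    (hπ : ExtendsToGroupVNIso π) {φ : (repVN π).toStarSubalgebra →ₗ[ℂ] ℂ} (hφ : IsTracialState φ)
    (hφn : IsNormalFunctional (repVN π) φ) {h : G} (hh : (conjugatesOf h).Infinite) :
    φ (repVN.of π h) = 0 := by
  obtain ⟨θ, hθ⟩ := hπ
  have hθ' : ∀ g, θ (groupVN.of g) = repVN.of π g := fun g => Subtype.ext (hθ g)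
  let c : ℕ → G := fun i => hh.natEmbedding _ i
  have hc : ∀ i, IsConj h (c i) := fun i => (hh.natEmbedding _ i).2
  have hcinj : Function.Injective c := fun i j hij =>
    (hh.natEmbedding _).injective (Subtype.ext hij)
  -- Averaging 2^n distinct conjugates makes the squared 2-norm exactly 2^(-n), the decay required
  -- by the comparison lemma.
  let x : ℕ → (groupVN G).toStarSubalgebra := fun n =>
    ∑ i ∈ Finset.range (2 ^ n), ((1 / 2 : ℂ) ^ n) • groupVN.of (c i)
  have hx1 : ∀ n, ‖x n‖ ≤ 1 := fun n => by
    refine (norm_sum_le _ _).trans ?_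
    refine (Finset.sum_le_sum (g := fun _ => (1 / 2 : ℝ) ^ n) fun i _ => ?_).trans ?_
    · rw [norm_smul]
      have h1 : ‖(1 / 2 : ℂ) ^ n‖ = (1 / 2) ^ n := by simp
      rw [h1]
      exact mul_le_of_le_one_right (by positivity) (groupVN.norm_of_le _)
    · simp
  have hxδ : ∀ n, (x n : EllTwo G →L[ℂ] EllTwo G) (delta 1) =
      ∑ i ∈ Finset.range (2 ^ n), ((1 / 2 : ℂ) ^ n) • delta (c i) := fun n => by
    simp only [x, AddSubmonoidClass.coe_finsetSum, sum_apply]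
    refine Finset.sum_congr rfl fun i _ => ?_
    change ((1 / 2 : ℂ) ^ n) • (leftRegular G (c i) : EllTwo G →L[ℂ] EllTwo G) (delta 1) = _
    rw [leftRegular_delta, mul_one]
  have hτ : ∀ n, groupVN.vectorTrace G (star (x n) * x n) = ((1 / 2 : ℝ) ^ n : ℝ) := fun n => by
    rw [groupVN.vectorTrace_star_mul_self, hxδ]
    have h1 := (orthonormal_delta.comp c hcinj).inner_sum (fun _ => (1 / 2 : ℂ) ^ n)
      (fun _ => (1 / 2 : ℂ) ^ n) (Finset.range (2 ^ n))
    simp only [Function.comp_apply] at h1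
    rw [inner_self_eq_norm_sq_to_K] at h1
    have h2 : (2 : ℂ) ^ n ≠ 0 := by positivity
    have h3 : ∑ i ∈ Finset.range (2 ^ n), (starRingEnd ℂ) ((1 / 2 : ℂ) ^ n) * (1 / 2 : ℂ) ^ n =
        (1 / 2 : ℂ) ^ n := by
      have h4 : (starRingEnd ℂ) ((1 / 2 : ℂ) ^ n) = (1 / 2) ^ n := by simp [Complex.conj_ofNat]
      rw [h4]
      simp [field]
    rw [h3] at h1
    push_cast
    exact h1
  -- Averaging does not change the trace, since φ is constant on the conjugacy class.
  have hφx : ∀ n, φ (θ (x n)) = φ (repVN.of π h) := fun n => by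
    simp only [x, map_sum, map_smul, hθ', hφ.map_of_conj (hc _)]
    simp
  have key := nonpos_of_forall_le_of_geometric θ groupVN.vectorTrace_nonneg
    groupVN.isNormalFunctional_vectorTrace groupVN.vectorTrace_faithful hφ.nonneg hφn
    (a := fun n => star (x n) * x n) (fun n => star_mul_self_nonneg _)
    (fun n => by
      rw [CStarRing.norm_star_mul_self]
      exact mul_le_one₀ (hx1 n) (norm_nonneg _) (hx1 n))
    (fun n => by rw [hτ]; exact le_rfl) (δ := ‖φ (repVN.of π h)‖ ^ 2)
    (fun n => by
      have h1 : θ (star (x n) * x n) = star (θ (x n)) * θ (x n) :=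
        (map_mul θ _ _).trans (congrArg (· * θ (x n)) (θ.map_star' (x n)))
      rw [h1, ← hφx n]
      exact hφ.norm_sq_le _)
  exact norm_eq_zero.mp (pow_eq_zero_iff two_ne_zero |>.mp (le_antisymm key (sq_nonneg _)))

end ICC

/-! ### Rigidity determines the trace on the group -/

section Rigid

variable {Γ : Type*} [Group Γ] {H : Type*} [NormedAddCommGroup H] [InnerProductSpace ℂ H]
  [CompleteSpace H]

/-- A unitary representation as a homomorphism into the unitary group of `π(Γ)''`. -/
def repVN.unitaryOf (π : Γ →* unitary (H →L[ℂ] H)) :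
    Γ →* unitary (repVN π).toStarSubalgebra where
  toFun g := ⟨repVN.of π g, by
    rw [Unitary.mem_iff, repVN.star_of, ← repVN.of_mul, ← repVN.of_mul, inv_mul_cancel,
      mul_inv_cancel, repVN.of_one]
    exact ⟨rfl, rfl⟩⟩
  map_one' := Subtype.ext (repVN.of_one π)
  map_mul' g h := Subtype.ext (repVN.of_mul π g h)

theorem repVN_comp_le {G : Type*} [Group G] (π : Γ →* unitary (H →L[ℂ] H)) (f : G →* Γ) :
    (repVN (π.comp f)).toStarSubalgebra ≤ (repVN π).toStarSubalgebra := by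
  intro x hx
  have hx' : x ∈ (repVN (π.comp f) : Set (H →L[ℂ] H)) := hx
  change x ∈ (repVN π : Set (H →L[ℂ] H))
  rw [coe_repVN] at hx' ⊢
  refine Set.centralizer_subset (Set.centralizer_subset ?_) hx'
  rintro _ ⟨g, rfl⟩
  exact ⟨f g, rfl⟩

theorem FullGroupCStar.continuous_starAlgHom {A : Type*} [CStarAlgebra A]
    (f : FullGroupCStar Γ →⋆ₐ[ℂ] A) : Continuous f :=
  AddMonoidHomClass.continuous_of_bound f 1 fun a => by
    rw [one_mul]; exact NonUnitalStarAlgHom.norm_apply_le f a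

theorem FullGroupCStar.continuous_canonicalTrace : Continuous (canonicalTrace Γ) := by
  have h := FullGroupCStar.continuous_starAlgHom (FullGroupCStar.lift (leftRegular Γ))
  exact (innerSL ℂ (deltaOne Γ)).continuous.comp
    ((ContinuousLinearMap.apply ℂ (EllTwo Γ) (deltaOne Γ)).continuous.comp h)

theorem FullGroupCStar.ext_of {f f' : FullGroupCStar Γ →ₗ[ℂ] ℂ} (hf : Continuous f)
    (hf' : Continuous f')
    (h : ∀ g : Γ, f (of g : unitary (FullGroupCStar Γ)) = f' (of g : unitary (FullGroupCStar Γ))) :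
    f = f' := by
  refine LinearMap.ext fun a => ?_
  induction a using induction_on with
  | hc => exact isClosed_eq hf hf'
  | h a =>
    induction a using GroupAlg.induction_linear with
    | zero => simp
    | add x y hx hy => simp only [map_add, hx, hy]
    | single g c =>
      have h1 : (coeHom (GroupAlg.single g c) : FullGroupCStar Γ) =
          c • ((of g : unitary (FullGroupCStar Γ)) : FullGroupCStar Γ) := by
        change coeHom (GroupAlg.single g c) = c • coeHom (GroupAlg.single g 1)
        rw [← map_smul, GroupAlg.smul_single, mul_one]
      rw [h1, map_smul, map_smul, h]

open scoped Classical in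
-- Rigidity is applied to φ pulled back to C⋆(Γ). The icc condition supplies the required values on
-- Λ, through the restriction of φ to π(Λ)'', which stays normal with the same vectors.
theorem map_of_eq_ite {Λ : Subgroup Γ} (hrigid : TracialRigid Λ) (hicc : IsICC Λ)
    {π : Γ →* unitary (H →L[ℂ] H)} {φ : (repVN π).toStarSubalgebra →ₗ[ℂ] ℂ}
    (hφ : IsTracialState φ) (hφn : IsNormalFunctional (repVN π) φ)
    (hΛ : ExtendsToGroupVNIso (π.comp Λ.subtype)) (g : Γ) :
    φ (repVN.of π g) = if g = 1 then 1 else 0 := by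
  let j := StarSubalgebra.inclusion (repVN_comp_le π Λ.subtype)
  let φ' : (repVN (π.comp Λ.subtype)).toStarSubalgebra →ₗ[ℂ] ℂ :=
    φ ∘ₗ j.toAlgHom.toLinearMap
  have hφ' : IsTracialState φ' :=
    { nonneg := fun a => hφ.nonneg (j a)
      map_one := hφ.map_one
      map_mul_comm := fun a b => hφ.map_mul_comm (j a) (j b) }
  have hφn' : IsNormalFunctional _ φ' := by
    obtain ⟨ξ, η, hξ, hη, h⟩ := hφn
    exact ⟨ξ, η, hξ, hη, fun x => h (j x)⟩
  let L := FullGroupCStar.lift (repVN.unitaryOf π)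
  let τ : FullGroupCStar Γ →ₗ[ℂ] ℂ := φ ∘ₗ L.toAlgHom.toLinearMap
  have hτ : IsTracialState τ :=
    { nonneg := fun a => by
        change 0 ≤ φ (L (star a * a))
        rw [map_mul, map_star]
        exact hφ.nonneg _
      map_one := by
        change φ (L 1) = 1
        rw [map_one, hφ.map_one]
      map_mul_comm := fun a b => by
        change φ (L (a * b)) = φ (L (b * a))
        rw [map_mul L, map_mul L, hφ.map_mul_comm] }
  have hτc : Continuous τ := hφn.continuous.comp (FullGroupCStar.continuous_starAlgHom L)
  have hτof : ∀ g, τ (FullGroupCStar.of g : FullGroupCStar Γ) = φ (repVN.of π g) := fun g =>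
    congrArg φ (FullGroupCStar.lift_of (repVN.unitaryOf π) g)
  have hres : τ ∘ₗ (FullGroupCStar.incl Λ).toAlgHom.toLinearMap = canonicalTrace Λ := by
    refine FullGroupCStar.ext_of (hτc.comp (FullGroupCStar.continuous_starAlgHom _))
      FullGroupCStar.continuous_canonicalTrace fun h => ?_
    rw [canonicalTrace_of]
    have h1 : FullGroupCStar.incl Λ (FullGroupCStar.of h : FullGroupCStar Λ) =
      (FullGroupCStar.of (h : Γ) : FullGroupCStar Γ) := FullGroupCStar.lift_of _ h
    change τ (FullGroupCStar.incl Λ (FullGroupCStar.of h : FullGroupCStar Λ)) = _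
    rw [h1, hτof]
    split_ifs with h0
    · rw [h0, OneMemClass.coe_one, repVN.of_one, hφ.map_one]
    · exact map_of_eq_zero_of_infinite_conjugates hΛ hφ' hφn' (hicc h h0)
  rw [← hτof, hrigid τ hτ fun a => congrArg (fun f => f a) hres, canonicalTrace_of]

end Rigid

/-! ### Amplifications and the density theorem -/

section Amplification

variable {ι : Type*} {H : Type*} [NormedAddCommGroup H]

theorem hasSum_norm_sq_lp (v : lp (fun _ : ι => H) 2) :
    HasSum (fun i => ‖v i‖ ^ 2) (‖v‖ ^ 2) := by
  have h := lp.hasSum_norm (p := 2) (by norm_num) v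
  simpa using h

theorem memℓp_two_of_summable {v : ι → H} (hv : Summable fun i => ‖v i‖ ^ 2) : Memℓp v 2 := by
  rw [memℓp_gen_iff (by norm_num)]
  simpa using hv

variable [InnerProductSpace ℂ H]

theorem summable_norm_apply_sq (a : H →L[ℂ] H) {v : ι → H} (hv : Summable fun i => ‖v i‖ ^ 2) :
    Summable fun i => ‖a (v i)‖ ^ 2 :=
  (hv.mul_left (‖a‖ ^ 2)).of_nonneg_of_le (fun _ => sq_nonneg _) fun i => by
    rw [← mul_pow]
    exact pow_le_pow_left₀ (norm_nonneg _) (a.le_opNorm _) 2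

/-- The diagonal amplification of an operator to `ℓ²(ι, H)`. -/
def amplify (ι : Type*) (a : H →L[ℂ] H) :
    lp (fun _ : ι => H) 2 →L[ℂ] lp (fun _ : ι => H) 2 :=
  LinearMap.mkContinuous
    { toFun := fun v => ⟨fun i => a (v i),
        memℓp_two_of_summable (summable_norm_apply_sq a (hasSum_norm_sq_lp v).summable)⟩
      map_add' := fun v w => lp.ext <| funext fun i => map_add a (v i) (w i)
      map_smul' := fun c v => lp.ext <| funext fun i => map_smul a c (v i) } ‖a‖ fun v => by
    refine le_of_sq_le_sq ?_ (by positivity)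
    rw [mul_pow]
    refine hasSum_le (fun i => ?_) (hasSum_norm_sq_lp _)
      ((hasSum_norm_sq_lp v).mul_left (‖a‖ ^ 2))
    rw [← mul_pow]
    exact pow_le_pow_left₀ (norm_nonneg _) (a.le_opNorm _) 2

theorem amplify_apply (a : H →L[ℂ] H) (v : lp (fun _ : ι => H) 2) (i : ι) :
    amplify ι a v i = a (v i) := rfl

theorem amplify_single [DecidableEq ι] (a : H →L[ℂ] H) (i : ι) (x : H) :
    amplify ι a (lp.single 2 i x) = lp.single 2 i (a x) := by
  refine lp.ext <| funext fun j => ?_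
  rw [amplify_apply, lp.single_apply, lp.single_apply]
  by_cases h : j = i
  · subst h; simp
  · simp [h]

/-- An operator on `ℓ²(ι, H)` which commutes with the amplifications of a set of operators commutes
with the amplifications of the double commutant. -/
theorem commute_amplify_of_mem_centralizer {s : Set (H →L[ℂ] H)}
    {P : lp (fun _ : ι => H) 2 →L[ℂ] lp (fun _ : ι => H) 2}
    (hP : ∀ a ∈ s, Commute (amplify ι a) P) {x : H →L[ℂ] H}
    (hx : x ∈ Set.centralizer (Set.centralizer s)) : Commute (amplify ι x) P := by
  classical
  -- The matrix entries of P lie in the commutant of `s`, hence commute with x; P is determined by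
  -- its entries.
  let Q : ι → ι → H →L[ℂ] H := fun i j =>
    lp.evalCLM ℂ (fun _ : ι => H) 2 i ∘L P ∘L lp.singleContinuousLinearMap ℂ (fun _ : ι => H) 2 j
  have hQ : ∀ i j, Q i j ∈ Set.centralizer s := fun i j a ha => by
    refine ContinuousLinearMap.ext fun v => ?_
    change a ((P (lp.single 2 j v)) i) = (P (lp.single 2 j (a v))) i
    rw [← amplify_single, ← amplify_apply]
    exact congrArg (fun T : lp (fun _ : ι => H) 2 →L[ℂ] lp (fun _ : ι => H) 2 =>
      T (lp.single 2 j v) i) (hP a ha)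
  refine lp.ext_continuousLinearMap (by simp) fun j => ContinuousLinearMap.ext fun v =>
    lp.ext <| funext fun i => ?_
  change x ((P (lp.single 2 j v)) i) = (P (amplify ι x (lp.single 2 j v))) i
  rw [amplify_single]
  exact (congrArg (fun T : H →L[ℂ] H => T v) (hx _ (hQ i j))).symm

theorem amplify_inner [CompleteSpace H] (u : unitary (H →L[ℂ] H)) (v w : lp (fun _ : ι => H) 2) :
    ⟪amplify ι (u : H →L[ℂ] H) v, w⟫_ℂ =
      ⟪v, amplify ι ((star u : unitary (H →L[ℂ] H)) : H →L[ℂ] H) w⟫_ℂ := by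
  rw [lp.inner_eq_tsum, lp.inner_eq_tsum]
  refine tsum_congr fun i => ?_
  rw [amplify_apply, amplify_apply, Unitary.coe_star, ContinuousLinearMap.star_eq_adjoint,
    ContinuousLinearMap.adjoint_inner_right]

end Amplification

section Density

variable {G : Type*} [Group G] {H : Type*} [NormedAddCommGroup H] [InnerProductSpace ℂ H]
  [CompleteSpace H]

/-- Every element of `π(G)''` is approximated by linear combinations of the `π g` on
square-summable families of vectors. -/
theorem exists_span_tsum_norm_sub_sq_lt (π : G →* unitary (H →L[ℂ] H)) {ι : Type*} {ζ : ι → H}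
    (hζ : Summable fun i => ‖ζ i‖ ^ 2) (x : (repVN π).toStarSubalgebra) {ε : ℝ} (hε : 0 < ε) :
    ∃ a ∈ Submodule.span ℂ (Set.range (repVN.of π)),
      ∑' i, ‖((x - a : (repVN π).toStarSubalgebra) : H →L[ℂ] H) (ζ i)‖ ^ 2 < ε := by
  let z : lp (fun _ : ι => H) 2 := ⟨ζ, memℓp_two_of_summable hζ⟩
  let v : G → lp (fun _ : ι => H) 2 := fun g => amplify ι (π g : H →L[ℂ] H) z
  let S := Submodule.span ℂ (Set.range v)
  let E := S.topologicalClosure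
  have : CompleteSpace E := S.isClosed_topologicalClosure.completeSpace_coe
  have hEg : ∀ g, ∀ w ∈ E, amplify ι (π g : H →L[ℂ] H) w ∈ E := fun g => by
    have h1 : ∀ w ∈ S, amplify ι (π g : H →L[ℂ] H) w ∈ S := fun w hw => by
      induction hw using Submodule.span_induction with
      | mem w hw =>
        obtain ⟨k, rfl⟩ := hw
        refine Submodule.subset_span ⟨g * k, lp.ext <| funext fun i => ?_⟩
        simp [v, amplify_apply]
      | zero => rw [map_zero]; exact zero_mem _
      | add w w' _ _ h h' => rw [map_add]; exact add_mem h h'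
      | smul c w _ h => rw [map_smul]; exact S.smul_mem c h
    intro w hw
    exact map_mem_closure (amplify ι (π g : H →L[ℂ] H)).continuous hw h1
  have hEg' : ∀ g, ∀ w ∈ Eᗮ, amplify ι (π g : H →L[ℂ] H) w ∈ Eᗮ := fun g w hw u hu => by
    rw [← inner_conj_symm, amplify_inner, inner_conj_symm]
    have h : star (π g) = π g⁻¹ := by rw [map_inv, Unitary.star_eq_inv]
    rw [h]
    exact hw _ (hEg g⁻¹ u hu)
  -- The closed span E of the orbit of z reduces the amplified representation. Its projection
  -- therefore commutes with the amplification of x, which keeps the image of z in E.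
  have hP : ∀ a ∈ repRange π, Commute (amplify ι a) E.starProjection := by
    rintro _ ⟨g, rfl⟩
    refine ContinuousLinearMap.ext fun w => ?_
    change amplify ι (π g : H →L[ℂ] H) (E.starProjection w) =
      E.starProjection (amplify ι (π g : H →L[ℂ] H) w)
    symm
    refine Submodule.eq_starProjection_of_mem_of_inner_eq_zero
      (hEg g _ (E.starProjection_apply_mem w)) fun u hu => ?_
    rw [← map_sub]
    exact Submodule.inner_left_of_mem_orthogonal hu (hEg' g _ (E.sub_starProjection_mem_orthogonal w))
  have hx : (x : H →L[ℂ] H) ∈ Set.centralizer (Set.centralizer (repRange π)) := by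
    rw [← coe_repVN]; exact x.2
  have hzE : z ∈ E := S.le_topologicalClosure (Submodule.subset_span ⟨1, lp.ext <| funext fun i => by
    simp [v, amplify_apply]⟩)
  have hxz : amplify ι (x : H →L[ℂ] H) z ∈ closure (S : Set (lp (fun _ : ι => H) 2)) := by
    have h := congrArg (fun T : lp (fun _ : ι => H) 2 →L[ℂ] lp (fun _ : ι => H) 2 => T z)
      (commute_amplify_of_mem_centralizer hP hx).eq
    change amplify ι (x : H →L[ℂ] H) (E.starProjection z) = E.starProjection _ at h
    rw [Submodule.starProjection_eq_self_iff.mpr hzE] at h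
    rw [h]
    exact E.starProjection_apply_mem _
  obtain ⟨w, hw, hwx⟩ := Metric.mem_closure_iff.mp hxz (√ε) (Real.sqrt_pos.mpr hε)
  have hS : ∀ w ∈ S, ∃ a ∈ Submodule.span ℂ (Set.range (repVN.of π)),
      ∀ i, w i = (a : H →L[ℂ] H) (ζ i) := fun w hw => by
    induction hw using Submodule.span_induction with
    | mem w hw =>
      obtain ⟨k, rfl⟩ := hw
      exact ⟨repVN.of π k, Submodule.subset_span ⟨k, rfl⟩, fun i => rfl⟩
    | zero => exact ⟨0, zero_mem _, fun i => rfl⟩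
    | add w w' _ _ h h' =>
      obtain ⟨a, ha, haw⟩ := h
      obtain ⟨b, hb, hbw⟩ := h'
      refine ⟨a + b, add_mem ha hb, fun i => ?_⟩
      change w i + w' i = (a : H →L[ℂ] H) (ζ i) + (b : H →L[ℂ] H) (ζ i)
      rw [haw, hbw]
    | smul c w _ h =>
      obtain ⟨a, ha, haw⟩ := h
      refine ⟨c • a, Submodule.smul_mem _ c ha, fun i => ?_⟩
      change c • w i = c • (a : H →L[ℂ] H) (ζ i)
      rw [haw]
  obtain ⟨a, ha, haw⟩ := hS w hw
  refine ⟨a, ha, ?_⟩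
  have h1 := (hasSum_norm_sq_lp (amplify ι (x : H →L[ℂ] H) z - w)).tsum_eq
  have h2 : ∀ i, ((x - a : (repVN π).toStarSubalgebra) : H →L[ℂ] H) (ζ i) =
      (amplify ι (x : H →L[ℂ] H) z - w) i := fun i => by
    change (x : H →L[ℂ] H) (ζ i) - (a : H →L[ℂ] H) (ζ i) = (x : H →L[ℂ] H) (ζ i) - w i
    rw [haw]
  simp only [h2]
  rw [h1, ← dist_eq_norm]
  calc dist (amplify ι (x : H →L[ℂ] H) z) w ^ 2 < √ε ^ 2 := by gcongr
    _ = ε := Real.sq_sqrt hε.le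

/-- The linear combinations of the `π g` are dense in `π(G)''` in the `2`-norm of a normal
functional. -/
theorem exists_span_re_map_star_mul_self_lt {π : G →* unitary (H →L[ℂ] H)}
    {φ : (repVN π).toStarSubalgebra →ₗ[ℂ] ℂ} (hφn : IsNormalFunctional (repVN π) φ)
    (x : (repVN π).toStarSubalgebra) {ε : ℝ} (hε : 0 < ε) :
    ∃ a ∈ Submodule.span ℂ (Set.range (repVN.of π)), (φ (star (x - a) * (x - a))).re < ε := by
  obtain ⟨ξ, η, hξ, hη, hφ⟩ := hφn
  -- Both families must be approximated at once: φ(y⋆y) is the sum of ⟪y η_n, y ξ_n⟫, bounded by the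
  -- sums of ‖y ξ_n‖² and ‖y η_n‖².
  have hζ : Summable fun i : ℕ ⊕ ℕ => ‖Sum.elim ξ η i‖ ^ 2 := by
    exact (HasSum.sum (f := fun i : ℕ ⊕ ℕ => ‖Sum.elim ξ η i‖ ^ 2) hξ.hasSum hη.hasSum).summable
  obtain ⟨a, ha, hlt⟩ := exists_span_tsum_norm_sub_sq_lt π hζ x hε
  refine ⟨a, ha, lt_of_le_of_lt ?_ hlt⟩
  generalize x - a = y
  have hyξ := summable_norm_apply_sq (y : H →L[ℂ] H) hξ
  have hyη := summable_norm_apply_sq (y : H →L[ℂ] H) hη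
  have hsum := HasSum.sum (f := fun i : ℕ ⊕ ℕ => ‖(y : H →L[ℂ] H) (Sum.elim ξ η i)‖ ^ 2)
    hyξ.hasSum hyη.hasSum
  rw [hsum.tsum_eq]
  have hre := Complex.hasSum_re (hφ (star y * y))
  refine hasSum_le (fun n => ?_) hre (hyξ.hasSum.add hyη.hasSum)
  change (⟪η n, ContinuousLinearMap.adjoint (y : H →L[ℂ] H) ((y : H →L[ℂ] H) (ξ n))⟫_ℂ).re ≤ _
  rw [ContinuousLinearMap.adjoint_inner_right]
  have h1 := (Complex.re_le_norm _).trans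
    (norm_inner_le_norm (𝕜 := ℂ) ((y : H →L[ℂ] H) (η n)) ((y : H →L[ℂ] H) (ξ n)))
  nlinarith [sq_nonneg (‖(y : H →L[ℂ] H) (η n)‖ - ‖(y : H →L[ℂ] H) (ξ n)‖),
    sq_nonneg (‖(y : H →L[ℂ] H) (η n)‖ + ‖(y : H →L[ℂ] H) (ξ n)‖)]

end Density

/-! ### The standard representation of a trace which agrees with the canonical trace -/

/-- The spectrum is real, so |z + i| ≥ 1 on it. The bound on the inverse does not depend on ‖b‖,
which is what makes resolvents of unbounded sequences usable. -/
theorem IsSelfAdjoint.exists_inverse_add_I {A : Type*} [CStarAlgebra A] {b : A}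
    (hb : IsSelfAdjoint b) :
    ∃ y : A, ‖y‖ ≤ 1 ∧ y * (b + Complex.I • 1) = 1 ∧ (b + Complex.I • 1) * y = 1 := by
  have hne : ∀ z ∈ spectrum ℂ b, z + Complex.I ≠ 0 := fun z hz h => by
    have h1 := congrArg Complex.im h
    rw [hb.mem_spectrum_eq_re hz] at h1
    simp at h1
  have hc : ContinuousOn (fun z : ℂ => (z + Complex.I)⁻¹) (spectrum ℂ b) :=
    (by fun_prop : ContinuousOn (fun z : ℂ => z + Complex.I) _).inv₀ hne
  have hn : IsStarNormal b := hb.isStarNormal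
  have h2 : cfc (fun z : ℂ => z + Complex.I) b = b + Complex.I • 1 := by
    rw [cfc_add_const Complex.I (fun z : ℂ => z) b, cfc_id' ℂ b, Algebra.algebraMap_eq_smul_one]
  refine ⟨cfc (fun z : ℂ => (z + Complex.I)⁻¹) b, norm_cfc_le zero_le_one fun z hz => ?_, ?_, ?_⟩
  · rw [norm_inv]
    refine inv_le_one_of_one_le₀ ?_
    rw [hb.mem_spectrum_eq_re hz]
    refine le_trans ?_ (Complex.abs_im_le_norm _)
    simp
  · rw [← h2, ← cfc_mul _ _ b hc (by fun_prop), ← cfc_one ℂ b]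
    exact cfc_congr fun z hz => inv_mul_cancel₀ (hne z hz)
  · rw [← h2, ← cfc_mul _ _ b (by fun_prop) hc, ← cfc_one ℂ b]
    exact cfc_congr fun z hz => mul_inv_cancel₀ (hne z hz)

/-- The second resolvent identity bounds the distance of resolvents on a vector on which the
involution is isometric. -/
theorem norm_resolvent_sub_apply_le {K : Type*} [NormedAddCommGroup K] [InnerProductSpace ℂ K]
    [CompleteSpace K] {S B R Y : K →L[ℂ] K} {v : K} (hR : ‖R‖ ≤ 1) (hY : ‖Y‖ ≤ 1)
    (h1 : (S + Complex.I • 1) * R = 1) (h2 : Y * (B + Complex.I • 1) = 1)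
    (hv : ‖star ((S - B) * R) v‖ = ‖((S - B) * R) v‖) (hv' : ‖star (S - B) v‖ = ‖(S - B) v‖) :
    ‖Y v - R v‖ ≤ ‖(S - B) v‖ := by
  have h3 : Y - R = Y * ((S - B) * R) := by
    have h4 : S - B = (S + Complex.I • 1) - (B + Complex.I • 1) := by abel
    rw [h4, sub_mul, mul_sub, h1, mul_one, ← mul_assoc, h2, one_mul]
  have hR1 : ‖star R‖ ≤ 1 := by rw [norm_star]; exact hR
  calc ‖Y v - R v‖ = ‖Y (((S - B) * R) v)‖ :=
        congrArg (fun T : K →L[ℂ] K => ‖T v‖) h3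
    _ ≤ 1 * ‖((S - B) * R) v‖ := Y.le_of_opNorm_le hY _
    -- Taking adjoints moves R to the left, where its norm bound applies; a second use of the
    -- isometric involution restores S - B.
    _ = ‖star R (star (S - B) v)‖ := by
        rw [one_mul, ← hv, star_mul]
        rfl
    _ ≤ 1 * ‖star (S - B) v‖ := ContinuousLinearMap.le_of_opNorm_le _ hR1 _
    _ = ‖(S - B) v‖ := by rw [one_mul, hv']

/-- A closed star subalgebra containing the resolvent of `S` at `-i` contains `S`. -/
theorem StarSubalgebra.mem_of_inverse_add_I_mem {A : Type*} [CStarAlgebra A]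
    (B : StarSubalgebra ℂ A) [IsClosed (B : Set A)] {S R : A} (hR : R ∈ B)
    (h1 : R * (S + Complex.I • 1) = 1) (h2 : (S + Complex.I • 1) * R = 1) : S ∈ B := by
  -- Spectral permanence: an element of the closed subalgebra that is invertible in A is invertible
  -- in the subalgebra.
  have hunit : IsUnit (⟨R, hR⟩ : B) :=
    (StarSubalgebra.coe_isUnit B).mp (⟨⟨R, _, h1, h2⟩, rfl⟩ : IsUnit R)
  obtain ⟨r, hr⟩ := hunit.exists_right_inv
  have hr' : R * r = 1 := congrArg Subtype.val hr
  have hSr : S = r - Complex.I • 1 := eq_sub_of_add_eq (left_inv_eq_right_inv h2 hr')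
  rw [hSr]
  exact sub_mem r.2 (B.smul_mem (one_mem _) _)

section Standard

variable {G : Type*} [Group G] {H : Type*} [NormedAddCommGroup H] [InnerProductSpace ℂ H]
  [CompleteSpace H] {π : G →* unitary (H →L[ℂ] H)} {φ : (repVN π).toStarSubalgebra →ₗ[ℂ] ℂ}

namespace IsTracialState

/-- The vector of the GNS space of a tracial state defined by an element of the algebra. -/
def gnsVec (hφ : IsTracialState φ) : (repVN π).toStarSubalgebra →ₗ[ℂ] hφ.toPositive.GNS :=
  (UniformSpace.Completion.toComplₗᵢ (𝕜 := ℂ) (E := hφ.toPositive.PreGNS)).toLinearMap ∘ₗ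
    hφ.toPositive.toPreGNS.toLinearMap

theorem inner_gnsVec (hφ : IsTracialState φ) (x y : (repVN π).toStarSubalgebra) :
    ⟪hφ.gnsVec x, hφ.gnsVec y⟫_ℂ = φ (star x * y) :=
  UniformSpace.Completion.inner_coe _ _

theorem gnsStarAlgHom_gnsVec (hφ : IsTracialState φ) (x y : (repVN π).toStarSubalgebra) :
    hφ.toPositive.gnsStarAlgHom x (hφ.gnsVec y) = hφ.gnsVec (x * y) :=
  hφ.toPositive.gnsNonUnitalStarAlgHom_apply_coe

theorem denseRange_gnsVec (hφ : IsTracialState φ) : DenseRange hφ.gnsVec :=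
  UniformSpace.Completion.denseRange_coe.comp
    (f := hφ.toPositive.toPreGNS) hφ.toPositive.toPreGNS.surjective.denseRange
    (UniformSpace.Completion.continuous_coe _)

end IsTracialState

/-! ### Identification of the GNS space with ℓ²(G) -/

section GNS

variable {K : Type*} [NormedAddCommGroup K] [InnerProductSpace ℂ K]
  {Ω : (repVN π).toStarSubalgebra →ₗ[ℂ] K}

theorem norm_sq_of_inner_eq (hΩ : ∀ x y, ⟪Ω x, Ω y⟫_ℂ = φ (star x * y))
    (x : (repVN π).toStarSubalgebra) : ‖Ω x‖ ^ 2 = (φ (star x * x)).re := by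
  rw [← hΩ, inner_self_eq_norm_sq_to_K]
  norm_cast

open scoped Classical in
theorem orthonormal_of_inner_eq (hΩ : ∀ x y, ⟪Ω x, Ω y⟫_ℂ = φ (star x * y))
    (hg : ∀ g, φ (repVN.of π g) = if g = 1 then 1 else 0) :
    Orthonormal ℂ fun g => Ω (repVN.of π g) := by
  rw [orthonormal_iff_ite]
  intro g h
  rw [hΩ, repVN.star_of, ← repVN.of_mul, hg]
  simp only [inv_mul_eq_one]

/-- Distances between the vectors `Ω x` are 2-norm distances, so this is 2-norm density of the span
of the π(g). With orthonormality it yields a Hilbert basis indexed by G. -/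
theorem topologicalClosure_span_of_inner_eq (hφn : IsNormalFunctional (repVN π) φ)
    (hΩ : ∀ x y, ⟪Ω x, Ω y⟫_ℂ = φ (star x * y)) (hΩd : DenseRange Ω) :
    ⊤ ≤ (Submodule.span ℂ (Set.range fun g => Ω (repVN.of π g))).topologicalClosure := by
  intro v _
  refine hΩd.induction_on (p := fun v => v ∈ (Submodule.span ℂ
    (Set.range fun g => Ω (repVN.of π g))).topologicalClosure) v
    (Submodule.isClosed_topologicalClosure _) fun x => ?_
  refine Metric.mem_closure_iff.mpr fun ε hε => ?_
  obtain ⟨a, ha, hlt⟩ := exists_span_re_map_star_mul_self_lt hφn x (pow_pos hε 2)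
  refine ⟨Ω a, ?_, ?_⟩
  · change Ω a ∈ Submodule.span ℂ _
    have h := Submodule.mem_map_of_mem (f := Ω) ha
    rwa [Submodule.map_span, ← Set.range_comp] at h
  · rw [dist_eq_norm, ← map_sub]
    refine lt_of_pow_lt_pow_left₀ 2 hε.le ?_
    rwa [norm_sq_of_inner_eq hΩ]

theorem StarAlgHom.exists_conj {A K L : Type*} [Semiring A] [Algebra ℂ A] [Star A]
    [NormedAddCommGroup K] [InnerProductSpace ℂ K] [CompleteSpace K]
    [NormedAddCommGroup L] [InnerProductSpace ℂ L] [CompleteSpace L]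
    (ρ : A →⋆ₐ[ℂ] (K →L[ℂ] K)) (e : K ≃ₗᵢ[ℂ] L) :
    ∃ Φ : A →⋆ₐ[ℂ] (L →L[ℂ] L), ∀ x v, Φ x (e v) = e (ρ x v) :=
  ⟨(StarAlgEquiv.toStarAlgHom e.conjStarAlgEquiv).comp ρ, fun x v =>
    (e.conjStarAlgEquiv_apply_apply (ρ x) (e v)).trans (by rw [e.symm_apply_apply])⟩

/-- If a tracial state of `π(G)''` agrees with the canonical trace on `G`, then its GNS
representation is realized on `ℓ²(G)` with `π` going to the left regular representation. -/
theorem exists_starAlgHom_of_inner_eq [CompleteSpace K] (hφ : IsTracialState φ)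
    (hφn : IsNormalFunctional (repVN π) φ)
    (hg : ∀ g, φ (repVN.of π g) = haveI := Classical.dec (g = 1); if g = 1 then 1 else 0)
    (hΩ : ∀ x y, ⟪Ω x, Ω y⟫_ℂ = φ (star x * y)) (hΩd : DenseRange Ω)
    (ρ : (repVN π).toStarSubalgebra →⋆ₐ[ℂ] (K →L[ℂ] K)) (hρ : ∀ x y, ρ x (Ω y) = Ω (x * y)) :
    ∃ Φ : (repVN π).toStarSubalgebra →⋆ₐ[ℂ] (EllTwo G →L[ℂ] EllTwo G),
      (∀ g, Φ (repVN.of π g) = (leftRegular G g : EllTwo G →L[ℂ] EllTwo G)) ∧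
      (∀ x g, ‖Φ x (delta g)‖ ^ 2 = (φ (star x * x)).re) ∧
      (∀ x g, ⟪delta g, Φ x (delta 1)⟫_ℂ = φ (repVN.of π g⁻¹ * x)) ∧
      DenseRange fun x => Φ x (delta 1) := by
  obtain ⟨e, hb⟩ : ∃ e : K ≃ₗᵢ[ℂ] EllTwo G, ∀ g, e (Ω (repVN.of π g)) = delta g := by
    let b : HilbertBasis G ℂ K :=
      HilbertBasis.mk (orthonormal_of_inner_eq hΩ (fun g => by rw [hg]))
        (topologicalClosure_span_of_inner_eq hφn hΩ hΩd)
    refine ⟨b.repr, fun g => ?_⟩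
    let _ := Classical.decEq G
    have h1 := b.repr_self g
    rwa [HilbertBasis.coe_mk] at h1
  obtain ⟨Φ, hΦe⟩ := ρ.exists_conj e
  have hΦ : ∀ x g, Φ x (delta g) = e (Ω (x * repVN.of π g)) := fun x g => by
    rw [← hb, hΦe, hρ]
  have hΦ1 : ∀ x, Φ x (delta 1) = e (Ω x) := fun x => by
    rw [hΦ, repVN.of_one, mul_one]
  refine ⟨Φ, fun g => ext_delta fun h => ?_, fun x g => ?_, fun x g => ?_, ?_⟩
  · rw [hΦ, leftRegular_delta, ← repVN.of_mul, hb]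
  · have h1 : repVN.of π g * star (repVN.of π g) = 1 := by
      rw [repVN.star_of, ← repVN.of_mul, mul_inv_cancel, repVN.of_one]
    -- Traciality cancels π(g) against its adjoint, so the norm is the same at every basis vector.
    rw [hΦ, e.norm_map, norm_sq_of_inner_eq hΩ, ← mul_assoc, hφ.map_mul_comm, ← mul_assoc,
      star_mul, ← mul_assoc, h1, one_mul]
  · rw [hΦ1, ← hb, e.inner_map_map, hΩ, repVN.star_of]
  · simp only [hΦ1]
    exact e.surjective.denseRange.comp hΩd e.continuous

end GNS

theorem IsTracialState.exists_starAlgHom (hφ : IsTracialState φ)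
    (hφn : IsNormalFunctional (repVN π) φ)
    (hg : ∀ g, φ (repVN.of π g) = haveI := Classical.dec (g = 1); if g = 1 then 1 else 0) :
    ∃ Φ : (repVN π).toStarSubalgebra →⋆ₐ[ℂ] (EllTwo G →L[ℂ] EllTwo G),
      (∀ g, Φ (repVN.of π g) = (leftRegular G g : EllTwo G →L[ℂ] EllTwo G)) ∧
      (∀ x g, ‖Φ x (delta g)‖ ^ 2 = (φ (star x * x)).re) ∧
      (∀ x g, ⟪delta g, Φ x (delta 1)⟫_ℂ = φ (repVN.of π g⁻¹ * x)) ∧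
      DenseRange fun x => Φ x (delta 1) :=
  exists_starAlgHom_of_inner_eq hφ hφn hg hφ.inner_gnsVec hφ.denseRange_gnsVec
    hφ.toPositive.gnsStarAlgHom hφ.gnsStarAlgHom_gnsVec

/-- For T in the commutant of λ, the commutator of T with Φ(a) vanishes for a in the span of the
π(g). Replacing x by such an a changes the matrix coefficients of the commutator by an amount
controlled by Φ(x - a) and its adjoint at basis vectors, and traciality makes both norms equal to
the 2-norm of x - a. -/
theorem mem_groupVN_of_starAlgHom (hφ : IsTracialState φ) (hφn : IsNormalFunctional (repVN π) φ)
    {Φ : (repVN π).toStarSubalgebra →⋆ₐ[ℂ] (EllTwo G →L[ℂ] EllTwo G)}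
    (hΦg : ∀ g, Φ (repVN.of π g) = (leftRegular G g : EllTwo G →L[ℂ] EllTwo G))
    (hΦn : ∀ x g, ‖Φ x (delta g)‖ ^ 2 = (φ (star x * x)).re) (x : (repVN π).toStarSubalgebra) :
    Φ x ∈ (groupVN G).toStarSubalgebra := by
  change Φ x ∈ (groupVN G : Set (EllTwo G →L[ℂ] EllTwo G))
  unfold groupVN
  rw [coe_repVN]
  intro T hT
  have hspan : ∀ a ∈ Submodule.span ℂ (Set.range (repVN.of π)), T * Φ a = Φ a * T := by
    intro a ha
    induction ha using Submodule.span_induction with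
    | mem w hw =>
      obtain ⟨k, rfl⟩ := hw
      rw [hΦg]
      exact (hT _ ⟨k, rfl⟩).symm
    | zero => simp
    | add w w' _ _ h h' => rw [map_add, mul_add, add_mul, h, h']
    | smul c w _ h => rw [map_smul, mul_smul_comm, smul_mul_assoc, h]
  refine ext_delta fun k => ext_inner_delta fun j => ?_
  rw [← sub_eq_zero, ← inner_sub_right, ← norm_eq_zero]
  refine le_antisymm (le_of_forall_pos_le_add fun ε hε => ?_) (norm_nonneg _)
  rw [zero_add]
  -- The factor 2 covers the two terms of the commutator; the summand 1 covers T = 0.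
  have hδ : 0 < ε / (2 * ‖T‖ + 1) := by positivity
  obtain ⟨a, ha, hlt⟩ := exists_span_re_map_star_mul_self_lt hφn x (pow_pos hδ 2)
  have h1 : ∀ g, ‖Φ (x - a) (delta g)‖ ≤ ε / (2 * ‖T‖ + 1) := fun g => by
    refine le_of_sq_le_sq ?_ hδ.le
    rw [hΦn]; exact hlt.le
  have h2 : ∀ g, ‖star (Φ (x - a)) (delta g)‖ ≤ ε / (2 * ‖T‖ + 1) := fun g => by
    refine le_of_sq_le_sq ?_ hδ.le
    rw [← map_star, hΦn, star_star, hφ.map_mul_comm]; exact hlt.le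
  have hd : ∀ g : G, ‖delta g‖ = 1 := orthonormal_delta.norm_eq_one
  have h3 : (T * Φ x) (delta k) - (Φ x * T) (delta k) =
      T (Φ (x - a) (delta k)) - Φ (x - a) (T (delta k)) := by
    have h4 : T * Φ x - Φ x * T = T * Φ (x - a) - Φ (x - a) * T := by
      rw [map_sub, mul_sub, sub_mul, hspan a ha]; abel
    exact congrArg (fun S : EllTwo G →L[ℂ] EllTwo G => S (delta k)) h4
  rw [h3, inner_sub_right, ← ContinuousLinearMap.adjoint_inner_left (Φ (x - a)),
    ← ContinuousLinearMap.star_eq_adjoint]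
  calc _ ≤ ‖⟪delta j, T (Φ (x - a) (delta k))⟫_ℂ‖ +
        ‖⟪star (Φ (x - a)) (delta j), T (delta k)⟫_ℂ‖ := norm_sub_le _ _
    _ ≤ 1 * (‖T‖ * (ε / (2 * ‖T‖ + 1))) + ε / (2 * ‖T‖ + 1) * (‖T‖ * 1) := by
        refine add_le_add ((norm_inner_le_norm _ _).trans ?_) ((norm_inner_le_norm _ _).trans ?_)
        · rw [hd]
          gcongr
          exact T.le_opNorm_of_le (h1 k)
        · exact mul_le_mul (h2 j) (T.le_opNorm_of_le (hd k).le) (norm_nonneg _) hδ.le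
    _ = ε * (2 * ‖T‖ / (2 * ‖T‖ + 1)) := by ring
    _ ≤ ε * 1 := by
        gcongr
        rw [div_le_one (by positivity)]
        linarith
    _ = ε := mul_one _

/-- The self-adjoint part of any approximant is as good as the approximant, because the involution
of L(G) is isometric at δ_e. -/
theorem exists_isSelfAdjoint_norm_sub_apply_le
    {Φ : (repVN π).toStarSubalgebra →⋆ₐ[ℂ] (EllTwo G →L[ℂ] EllTwo G)}
    (hΦmem : ∀ x, Φ x ∈ (groupVN G).toStarSubalgebra)
    (hΦd : DenseRange fun x => Φ x (delta 1)) {S : EllTwo G →L[ℂ] EllTwo G}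
    (hSm : S ∈ (groupVN G).toStarSubalgebra) (hS : star S = S) {ε : ℝ} (hε : 0 < ε) :
    ∃ b : (repVN π).toStarSubalgebra, IsSelfAdjoint b ∧ ‖(S - Φ b) (delta 1)‖ ≤ ε := by
  obtain ⟨a, ha⟩ := hΦd.exists_dist_lt (S (delta 1)) hε
  have hZ : S - Φ a ∈ (groupVN G).toStarSubalgebra := sub_mem hSm (hΦmem a)
  rw [dist_eq_norm] at ha
  have h1 : ‖(S - Φ a) (delta 1)‖ ≤ ε := ha.le
  have h2 := h1
  rw [← groupVN.norm_star_apply_delta_one hZ] at h2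
  refine ⟨(1 / 2 : ℂ) • (a + star a), ?_, ?_⟩
  · rw [IsSelfAdjoint, star_smul, star_add, star_star, add_comm]
    simp
  · have h3 : S - Φ ((1 / 2 : ℂ) • (a + star a)) =
        (1 / 2 : ℂ) • ((S - Φ a) + star (S - Φ a)) := by
      rw [star_sub, hS, map_smul, map_add, map_star]
      module
    rw [h3, smul_apply, add_apply, norm_smul]
    have h4 := norm_add_le ((S - Φ a) (delta 1)) (star (S - Φ a) (delta 1))
    have h5 : ‖(1 / 2 : ℂ)‖ = 1 / 2 := by simp
    rw [h5]
    linarith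

/-- Resolvents take the place of a bounded approximation theorem: those of the approximants are
contractions, and at δ_e they converge in norm to the resolvent of S. -/
theorem mem_range_of_isSelfAdjoint (hφn : IsNormalFunctional (repVN π) φ)
    {Φ : (repVN π).toStarSubalgebra →⋆ₐ[ℂ] (EllTwo G →L[ℂ] EllTwo G)}
    (hΦinj : Function.Injective Φ) (hΦmem : ∀ x, Φ x ∈ (groupVN G).toStarSubalgebra)
    (hΦi : ∀ x g, ⟪delta g, Φ x (delta 1)⟫_ℂ = φ (repVN.of π g⁻¹ * x))
    (hΦd : DenseRange fun x => Φ x (delta 1)) {S : (groupVN G).toStarSubalgebra}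
    (hS : IsSelfAdjoint S) : (S : EllTwo G →L[ℂ] EllTwo G) ∈ Φ.range := by
  have hS' : star (S : EllTwo G →L[ℂ] EllTwo G) = S := congrArg Subtype.val hS.star_eq
  choose b hb hbS using fun n : ℕ => exists_isSelfAdjoint_norm_sub_apply_le hΦmem hΦd S.2 hS'
    (Nat.one_div_pos_of_nat (n := n) (α := ℝ))
  choose y hy1 hy2 hy3 using fun n => (hb n).exists_inverse_add_I
  obtain ⟨R, hR1, hR2, hR3⟩ := hS.exists_inverse_add_I
  have hyR : ∀ n, ‖Φ (y n) (delta 1) - (R : EllTwo G →L[ℂ] EllTwo G) (delta 1)‖ ≤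
      1 / ((n : ℝ) + 1) := fun n =>
    (norm_resolvent_sub_apply_le hR1
      ((NonUnitalStarAlgHom.norm_apply_le Φ _).trans (hy1 n)) (congrArg Subtype.val hR3)
      (by rw [← map_one Φ, ← map_smul, ← map_add, ← map_mul, hy2])
      (groupVN.norm_star_apply_delta_one (mul_mem (sub_mem S.2 (hΦmem (b n))) R.2))
      (groupVN.norm_star_apply_delta_one (sub_mem S.2 (hΦmem (b n))))).trans (hbS n)
  obtain ⟨z, hz⟩ := VonNeumannAlgebra.exists_weakTendsto (hyperfilter ℕ) hy1
  have hΦz : Φ z = R := by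
    refine groupVN.eq_of_apply_delta_one (hΦmem z) R.2 (ext_inner_delta fun g => ?_)
    -- Φ is not known to be weakly continuous, but its coefficients at δ_e are values of φ, and
    -- normality of φ passes to the limit.
    have h1 := hφn.tendsto (C := ‖repVN.of π g⁻¹‖ * 1)
      (fun n => (norm_mul_le _ _).trans (mul_le_mul_of_nonneg_left (hy1 n) (norm_nonneg _)))
      (hz.const_mul (repVN.of π g⁻¹))
    simp only [← hΦi] at h1
    have h2 : Tendsto (fun n => Φ (y n) (delta 1)) atTop
        (𝓝 ((R : EllTwo G →L[ℂ] EllTwo G) (delta 1))) :=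
      tendsto_iff_norm_sub_tendsto_zero.mpr
        (squeeze_zero (fun _ => norm_nonneg _) hyR tendsto_one_div_add_atTop_nhds_zero_nat)
    exact tendsto_nhds_unique h1
      ((tendsto_const_nhds.inner h2).mono_left Nat.hyperfilter_le_atTop)
  -- An injective ⋆-homomorphism of C⋆-algebras is isometric, so its range is complete.
  have hcl : IsClosed (Φ.range : Set (EllTwo G →L[ℂ] EllTwo G)) := by
    exact (NonUnitalStarAlgHom.isometry Φ hΦinj).isClosedEmbedding.isClosed_range
  exact StarSubalgebra.mem_of_inverse_add_I_mem Φ.range ⟨z, hΦz⟩ (congrArg Subtype.val hR2)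
    (congrArg Subtype.val hR3)

/-- A representation generating a von Neumann algebra with a faithful normal tracial state which
agrees with the canonical trace on `G` extends to an isomorphism with `L(G)`. -/
theorem extendsToGroupVNIso_of_map_of_eq_ite (hφ : IsTracialState φ)
    (hφn : IsNormalFunctional (repVN π) φ) (hφf : ∀ a, φ (star a * a) = 0 → a = 0)
    (hg : ∀ g, φ (repVN.of π g) = haveI := Classical.dec (g = 1); if g = 1 then 1 else 0) :
    ExtendsToGroupVNIso π := by
  obtain ⟨Φ, hΦg, hΦn, hΦi, hΦd⟩ := hφ.exists_starAlgHom hφn hg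
  have hΦmem := mem_groupVN_of_starAlgHom hφ hφn hΦg hΦn
  have hΦinj : Function.Injective Φ := by
    -- The squared norm of Φ(x)δ_e is φ(x⋆x), so faithfulness of φ gives injectivity.
    refine (injective_iff_map_eq_zero Φ).mpr fun x hx => hφf x ?_
    have h1 := hΦn x 1
    rw [hx, zero_apply, norm_zero, zero_pow two_ne_zero] at h1
    exact Complex.ext h1.symm (RCLike.nonneg_iff.mp (hφ.nonneg x)).2
  have hΦsurj : ∀ T : (groupVN G).toStarSubalgebra, (T : EllTwo G →L[ℂ] EllTwo G) ∈ Φ.range := by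
    intro T
    have h : ∀ S : selfAdjoint (groupVN G).toStarSubalgebra,
        ((S : (groupVN G).toStarSubalgebra) : EllTwo G →L[ℂ] EllTwo G) ∈ Φ.range := fun S =>
      mem_range_of_isSelfAdjoint hφn hΦinj hΦmem hΦi hΦd S.2
    rw [← realPart_add_I_smul_imaginaryPart T]
    exact add_mem (h _) (Φ.range.smul_mem (h _) _)
  let Ψ : (repVN π).toStarSubalgebra →⋆ₐ[ℂ] (groupVN G).toStarSubalgebra :=
    Φ.codRestrict _ hΦmem
  have hΨ : Function.Bijective Ψ :=
    ⟨fun x y h => hΦinj (congrArg Subtype.val h), fun T => by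
      obtain ⟨x, hx⟩ := hΦsurj T
      exact ⟨x, Subtype.ext hx⟩⟩
  refine ⟨(StarAlgEquiv.ofBijective Ψ hΨ).symm, fun g => ?_⟩
  have h1 : (StarAlgEquiv.ofBijective Ψ hΨ).symm (groupVN.of g) = repVN.of π g := by
    refine (StarAlgEquiv.ofBijective Ψ hΨ).injective
      ((StarAlgEquiv.apply_symm_apply _ _).trans ?_)
    exact Subtype.ext (hΦg g).symm
  exact congrArg Subtype.val h1

end Standard

end

theorem theorem7p7 {Γ : Type*} [Group Γ] [Countable Γ] (Λ : Subgroup Γ)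
    (hrigid : TracialRigid Λ) (hicc : IsICC Λ)
    {H : Type*} [NormedAddCommGroup H] [InnerProductSpace ℂ H] [CompleteSpace H]
    (π : Γ →* unitary (H →L[ℂ] H)) (hfin : IsFiniteVN (repVN π))
    (hΛ : ExtendsToGroupVNIso (π.comp Λ.subtype)) :
    ExtendsToGroupVNIso π := by
  obtain ⟨φ, hφ, hφn, hφf⟩ := hfin
  exact extendsToGroupVNIso_of_map_of_eq_ite hφ hφn hφf fun g => by
    rw [map_of_eq_ite hrigid hicc hφ hφn hΛ]
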